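/- **Definitions.** Let $R=\begin{pmatrix}1&1\\1&0\end{pmatrix}$, and let $R_k=R^{\otimes k}$ be its $k$-fold Kronecker power, the $N\times N$ disjointness matrix with $N=2^k$. Rows and columns of $R^{\otimes d}$ are identified with subsets of $[d]$, so that $R^{\otimes d}_{S,T}=1$ if $S\cap T=\emptyset$ and $0$ otherwise. A *partitioning* of a $0/1$ matrix $M\in\{0,1\}^{I\times J}$ is a finite family of rectangles $I_i\times J_i$ ($I_i\subseteq I$, $J_i\subseteq J$) with $M=\sum_i \mathbb 1_{I_i}\mathbb 1_{J_i}^{\mathsf T}$. Its $\alpha$-volume is $\sum_i|I_i|^{\alpha}|J_i|^{1-\alpha}$. Let $\mathrm{Size}_{\mathsf{PAR}}(M)$ be the minimum of $\sum_i(|I_i|+|J_i|)$ over all partitionings of $M$, and $\sigma_{\mathsf{PAR}}(M)=\lim_{n\to\infty}\mathrm{Size}_{\mathsf{PAR}}(M^{\otimes n})^{1/n}$. A *depth-$d$ linear circuit* over a field $\mathbb F$ computing $M$ is a factorization $M=A_1A_2\cdots A_d$ into matrices over $\mathbb F$; its size is $\sum_j \mathrm{nnz}(A_j)$, where $\mathrm{nnz}$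 counts nonzero entries. *Merging procedure.* Let $w$ be a word in the letters $\mathtt R,\mathtt C,\mathtt R^+,\mathtt C^+$ with a number $a_i$ attached to every letter $w_i\in\{\mathtt R^+,\mathtt C^+\}$. Start with $r=c=0$ and the empty family of rectangles, and read $w$ from left to right. * At $\mathtt R$: for every $S\subseteq[d]$ with $|S|=r$ add the rectangle with the single row $S$ and columns $\{T: T\cap S=\emptyset,\ |T|\ge c\}$; then increase $r$ by $1$. * At $\mathtt R^+$ with number $a$: choose sets $S_1,\dots,S_a\subseteq[d]$ of size $r+1$ with $|S_j\cap S_k|<r$ for all $j\ne k$ (if none exist, the procedure fails). For each $j$ add the rectangle with rows $\{S\subseteq S_j:|S|\ge r\}$ and columns $\{T:T\cap S_j=\emptyset,\ |T|\ge c\}$. For every $S$ that either has size $r+1$ and is none of the $S_j$, or has size $r$ and is contained in no $S_j$, add the rectangle with the single row $S$ and columns $\{T:T\cap S=\emptyset,\ |T|\ge c\}$. For every $S$ of size $r$ contained in some $S_j$ add the rectangle with the single row $S$ and columns $\{T:T\cap S=\emptyset,\ T\cap S_j\neq\emptyset,\ |T|\ge c\}$. Then increase $r$ by $2$. * At $\mathtt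 C$ and $\mathtt C^+$: do the same with the roles of rows and columns, and of $r$ and $c$, exchanged. The output is the resulting family $I_{w,a}$ of rectangles, and $\rho_{w,a}(\alpha)$ denotes its $\alpha$-volume. Fix $d=18$ and $$w=\mathtt{R\,C\,R^+C^+R^+C^+R^+C^+R\,C\,R\,C\,R},\qquad a=(-,-,9,9,198,198,1260,1260,-,-,-,-,-).$$ **Theorem.** For this $w$ and $a$ the choices in the merging procedure can be made so that it does not fail, and for all admissible choices the output $I_{w,a}$ is a partitioning of $R^{\otimes 18}$. The limit defining $\sigma_{\mathsf{PAR}}(R)$ exists, and for all admissible choices $$\sigma_{\mathsf{PAR}}(R)\le\rho_{w,a}(1/2)^{1/18}<2^{1.249424}.$$ Consequently there is an absolute constant $K$ such that over any field, for all $k\ge 0$ and $N=2^k$, the matrix $R_k$ has a depth-2 linear circuit of size at most $K\,N^{1.249424}$. For every even $d\ge 2$ there is a constant $K_d$, depending only on $d$, such that over any field, for all $k\ge0$ and $N=2^k$, the matrix $R_k$ has a depth-$d$ linear circuit of size at most $K_d\,N^{1+0.498848/d}$. -/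

import Mathlib

open Filter Topology

universe u

/-! ### Matrices and Kronecker powers -/

/-- The `2 × 2` disjointness matrix `R`, with entries `0, 1` taken in `α`. -/
def disjointnessMatrix (α : Type*) [Zero α] [One α] : Matrix (Fin 2) (Fin 2) α :=
  !![1, 1; 1, 0]

/-- The `k`-fold Kronecker power of a matrix; rows and columns are indexed by `k`-tuples, and
the entry at a pair of tuples is the product of the entries at their coordinates. -/
def kroneckerPower {I J α : Type*} [CommSemiring α] (M : Matrix I J α) (k : ℕ) :
    Matrix (Fin k → I) (Fin k → J) α :=
  Matrix.of fun i j => ∏ t, M (i t) (j t)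

/-- The number of nonzero entries of a (finite) matrix. -/
noncomputable def nnz {I J α : Type*} [Zero α] (M : Matrix I J α) : ℕ :=
  {p : I × J | M p.1 p.2 ≠ 0}.ncard

/-! ### Linear circuits of depth `d` -/

/-- A synchronous linear circuit of depth `d` over `F` with inputs `J` and outputs `I`: a sequence
of `d` matrices `A₁, …, A_d` of compatible formats, where the layers strictly between
the outputs and the inputs consist of finitely many gates. -/
inductive LinearCircuit (F J : Type*) : Type → ℕ → Type _
  | last {I : Type} (A : Matrix I J F) : LinearCircuit F J I 1
  | cons {I : Type} {g d : ℕ} (A : Matrix I (Fin g) F) (C : LinearCircuit F J (Fin g) d) :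
      LinearCircuit F J I (d + 1)

namespace LinearCircuit

/-- The matrix `A₁ * ⋯ * A_d` computed by a circuit. -/
def matrix {F J : Type*} [Semiring F] : {I : Type} → {d : ℕ} → LinearCircuit F J I d → Matrix I J F
  | _, _, .last A => A
  | _, _, .cons A C => A * C.matrix

/-- The size (number of wires) `nnz A₁ + ⋯ + nnz A_d` of a circuit. -/
noncomputable def size {F J : Type*} [Zero F] : {I : Type} → {d : ℕ} → LinearCircuit F J I d → ℕ
  | _, _, .last A => nnz A
  | _, _, .cons A C => nnz A + C.size

end LinearCircuit

/-! ### Partitions into rectangles -/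

/-- A rectangle: a set of rows and a set of columns. -/
abbrev Rectangle (I J : Type*) := Finset I × Finset J

/-- A finite family of rectangles is a partitioning of the binary matrix `M` if `M` is
the sum of the indicator matrices of the rectangles. -/
def IsPartitioning {I J : Type*} [DecidableEq I] [DecidableEq J]
    (P : Multiset (Rectangle I J)) (M : Matrix I J ℕ) : Prop :=
  ∀ i j, (P.map fun Q => if i ∈ Q.1 ∧ j ∈ Q.2 then 1 else 0).sum = M i j

/-- The partitioning size of a binary matrix: the minimum of `∑ (|I_i| + |J_i|)` over all
partitionings. -/
noncomputable def sizePAR {I J : Type*} [DecidableEq I] [DecidableEq J] (M : Matrix I J ℕ) : ℕ :=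
  sInf {s | ∃ P : Multiset (Rectangle I J), IsPartitioning P M ∧
    (P.map fun Q => Q.1.card + Q.2.card).sum = s}

/-- The asymptotic partitioning size `lim_n sizePAR (M^{⊗ n}) ^ (1 / n)`. -/
noncomputable def sigmaPAR {I J : Type*} [DecidableEq I] [DecidableEq J] (M : Matrix I J ℕ) : ℝ :=
  limUnder atTop fun n : ℕ => (sizePAR (kroneckerPower M n) : ℝ) ^ (1 / (n : ℝ))

/-- The `α`-volume `∑ |I_i| ^ α * |J_i| ^ (1 - α)` of a family of rectangles. -/
noncomputable def alphaVolume {I J : Type*} (P : Multiset (Rectangle I J)) (α : ℝ) : ℝ :=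
  (P.map fun Q => (Q.1.card : ℝ) ^ α * (Q.2.card : ℝ) ^ (1 - α)).sum

/-! ### The merging procedure

Rows and columns of `R^{⊗ d}` are identified with subsets of `Fin d`. -/

/-- The `0/1`-vector of a subset of `Fin d`, which indexes a row or column of `R^{⊗ d}`. -/
def indicatorTuple {d : ℕ} (S : Finset (Fin d)) : Fin d → Fin 2 :=
  fun t => if t ∈ S then 1 else 0

/-- For each `S` of size `r`: the row `S` with the columns `T` disjoint from `S`, `|T| ≥ c`. -/
def rowRects (d r c : ℕ) : Multiset (Rectangle (Finset (Fin d)) (Finset (Fin d))) :=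
  (Finset.univ.filter fun S : Finset (Fin d) => S.card = r).val.map fun S =>
    ({S}, Finset.univ.filter fun T => Disjoint T S ∧ c ≤ T.card)

/-- An admissible choice for a merging step: `a` sets of size `r + 1` any two of which meet in
fewer than `r` points. -/
def IsPacking {d : ℕ} (r a : ℕ) (𝒮 : Finset (Finset (Fin d))) : Prop :=
  𝒮.card = a ∧ (∀ S ∈ 𝒮, S.card = r + 1) ∧
    ∀ S ∈ 𝒮, ∀ S' ∈ 𝒮, S ≠ S' → (S ∩ S').card < r

/-- The rectangles of a row merging step with chosen sets `𝒮`. -/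
def rowMergeRects (d r c : ℕ) (𝒮 : Finset (Finset (Fin d))) :
    Multiset (Rectangle (Finset (Fin d)) (Finset (Fin d))) :=
  -- each chosen set together with its subsets of size `r`, with their common columns
  (𝒮.val.map fun S' =>
    (Finset.univ.filter fun S => S ⊆ S' ∧ r ≤ S.card,
      Finset.univ.filter fun T => Disjoint T S' ∧ c ≤ T.card))
  -- the sets of size `r + 1` or `r` that were not merged
  + ((Finset.univ.filter fun S : Finset (Fin d) =>
      (S.card = r + 1 ∧ S ∉ 𝒮) ∨ (S.card = r ∧ ∀ S' ∈ 𝒮, ¬ S ⊆ S')).val.map fun S =>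
    ({S}, Finset.univ.filter fun T => Disjoint T S ∧ c ≤ T.card))
  -- the remaining columns of the merged sets of size `r`
  + (𝒮.val.bind fun S' => (Finset.univ.filter fun S => S ⊆ S' ∧ S.card = r).val.map fun S =>
    ({S}, Finset.univ.filter fun T => Disjoint T S ∧ ¬ Disjoint T S' ∧ c ≤ T.card))

/-- Exchange of the roles of rows and columns in a family of rectangles. -/
def swapRects {I J : Type*} (P : Multiset (Rectangle I J)) : Multiset (Rectangle J I) :=
  P.map Prod.swap

/-- The letters `R`, `C`, `R⁺`, `C⁺`; the merging letters carry the number of sets to be chosen. -/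
inductive Letter
  | row
  | col
  | rowMerge (a : ℕ)
  | colMerge (a : ℕ)

/-- `MergeRun d w r c P`: started with the counters `r` and `c`, the (nondeterministic) procedure
can process the word `w` without failure and output the family `P` of rectangles. -/
inductive MergeRun (d : ℕ) : List Letter → ℕ → ℕ →
    Multiset (Rectangle (Finset (Fin d)) (Finset (Fin d))) → Prop
  | nil (r c : ℕ) : MergeRun d [] r c 0
  | row {w r c P} (h : MergeRun d w (r + 1) c P) :
      MergeRun d (.row :: w) r c (rowRects d r c + P)
  | col {w r c P} (h : MergeRun d w r (c + 1) P) :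
      MergeRun d (.col :: w) r c (swapRects (rowRects d c r) + P)
  | rowMerge {w r c P a} (𝒮 : Finset (Finset (Fin d))) (h𝒮 : IsPacking r a 𝒮)
      (h : MergeRun d w (r + 2) c P) :
      MergeRun d (.rowMerge a :: w) r c (rowMergeRects d r c 𝒮 + P)
  | colMerge {w r c P a} (𝒮 : Finset (Finset (Fin d))) (h𝒮 : IsPacking c a 𝒮)
      (h : MergeRun d w r (c + 2) P) :
      MergeRun d (.colMerge a :: w) r c (swapRects (rowMergeRects d c r 𝒮) + P)

/-- The word `R C R⁺ C⁺ R⁺ C⁺ R⁺ C⁺ R C R C R` with the numbers `9, 9, 198, 198, 1260, 1260`. -/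
def mergeWord : List Letter :=
  [.row, .col, .rowMerge 9, .colMerge 9, .rowMerge 198, .colMerge 198, .rowMerge 1260,
    .colMerge 1260, .row, .col, .row, .col, .row]

/-!
A family of partitionings of `M = R^{⊗18}`, one of `p`-volume at most `V` for every `p ∈ [0, 1]`,
yields partitionings of `M^{⊗n}` by repeated refinement: a rectangle of shape `a × b` is multiplied
by the family for the weight `p` given by the share of `a ^ ε` in `a ^ ε + b ^ ε`. For small `ε`
this multiplies the sum of the smooth maxima `(a ^ ε + b ^ ε) ^ (1 / ε)` by at most
`V * exp (O (ε))`, so that `σ_PAR(R) ≤ V ^ (1 / 18)`.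

The shapes of the rectangles of an output of the merging procedure do not depend on the choices, and
its volume is a convex function of `p`. It is smaller at `6/11` than at `1/2`, hence at most
`V = ρ(1/2)` on `[1/2, 6/11]`. For `p ≥ 6/11` the partitioning into rows suffices, and for
`p < 1/2` one transposes, as `R` is symmetric. The choices exist because there are packings of `9`
pairs, of `198` quadruples in three hexagons, and of `1260` sextuples in two copies of nine points,
the last from proper colourings of subsets: a large set of Steiner triple systems and sums modulo
`9`.

A partitioning of size `s` is a depth-2 circuit of size `s`. For depth `2 * h` the `k` factors are
cut into `h` blocks of about equal length, each computed by a depth-2 circuit.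
-/

open scoped Kronecker

/-! ### Kronecker powers -/

theorem kroneckerPower_append {I J α : Type*} [CommSemiring α] (M : Matrix I J α) (m n : ℕ) :
    (kroneckerPower M (m + n)).submatrix (Fin.appendEquiv m n) (Fin.appendEquiv m n) =
      kroneckerPower M m ⊗ₖ kroneckerPower M n := by
  ext ⟨i, i'⟩ ⟨j, j'⟩
  simp [kroneckerPower, Fin.prod_univ_add, Fin.appendEquiv, Matrix.kroneckerMap_apply]

theorem kroneckerPower_map {I J α β : Type*} [CommSemiring α] [CommSemiring β] (f : α →+* β)
    (M : Matrix I J α) (k : ℕ) : (kroneckerPower M k).map f = kroneckerPower (M.map f) k := by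
  ext i j
  simp [kroneckerPower]

theorem disjointnessMatrix_map {α β : Type*} [Semiring α] [Semiring β] (f : α →+* β) :
    (disjointnessMatrix α).map f = disjointnessMatrix β := by
  ext i j
  fin_cases i <;> fin_cases j <;> simp [disjointnessMatrix]

/-! ### Linear circuits for Kronecker powers -/

theorem nnz_submatrix {I J I' J' α : Type*} [Zero α] (M : Matrix I J α) (e : I' ≃ I) (f : J' ≃ J) :
    nnz (M.submatrix e f) = nnz M := by
  simp only [nnz, ← Nat.card_coe_set_eq]
  exact Nat.card_congr ((e.prodCongr f).subtypeEquiv fun p => by simp)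

theorem nnz_kronecker_one {I J X α : Type*} [Semiring α] [DecidableEq X] (M : Matrix I J α) :
    nnz (M ⊗ₖ (1 : Matrix X X α)) = nnz M * Nat.card X := by
  simp only [nnz, ← Nat.card_coe_set_eq, ← Nat.card_prod]
  refine Nat.card_congr
    { toFun := fun p => (⟨(p.1.1.1, p.1.2.1), left_ne_zero_of_mul p.2⟩, p.1.1.2)
      invFun := fun q => ⟨((q.1.1.1, q.2), (q.1.1.2, q.2)), by
        simpa only [Set.mem_ofPred_eq, Matrix.kroneckerMap_apply, Matrix.one_apply_eq, mul_one]
          using q.1.2⟩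
      left_inv := ?_
      right_inv := fun _ => rfl }
  rintro ⟨⟨⟨i, x⟩, ⟨j, y⟩⟩, h⟩
  obtain rfl : x = y := by
    by_contra hne
    exact right_ne_zero_of_mul h (Matrix.one_apply_ne hne)
  rfl

theorem nnz_transpose {I J α : Type*} [Zero α] (M : Matrix I J α) : nnz M.transpose = nnz M := by
  simp only [nnz, ← Nat.card_coe_set_eq]
  exact Nat.card_congr ((Equiv.prodComm J I).subtypeEquiv fun p => by simp)

theorem nnz_indicator_le {I T α : Type*} [Semiring α] [DecidableEq I] [Fintype T]
    (s : T → Finset I) :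
    nnz (Matrix.of fun i t => if i ∈ s t then (1 : α) else 0) ≤ ∑ t, (s t).card := by
  have hsub : {p : I × T | Matrix.of (fun i t => if i ∈ s t then (1 : α) else 0) p.1 p.2 ≠ 0} ⊆
      ↑((Finset.univ.sigma s).map
        ((Equiv.sigmaEquivProd T I).trans (Equiv.prodComm T I)).toEmbedding) := by
    rintro ⟨i, t⟩ h
    have hi : i ∈ s t := by
      by_contra hi
      exact h (if_neg hi)
    simpa [Equiv.sigmaEquivProd] using hi
  calc _ ≤ _ := Set.ncard_le_ncard hsub
    _ = ∑ t, (s t).card := by rw [Set.ncard_coe_finset, Finset.card_map, Finset.card_sigma]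

namespace LinearCircuit

variable {F J J' : Type*}

/-- The circuit with its inputs and outputs renamed along bijections. -/
def reindex {I I' : Type} {d : ℕ} :
    LinearCircuit F J I d → (I' ≃ I) → (J' ≃ J) → LinearCircuit F J' I' d
  | .last A, e, f => .last (A.submatrix e f)
  | .cons A C, e, f => .cons (A.submatrix e (Equiv.refl _)) (C.reindex (Equiv.refl _) f)

/-- The composition of two circuits, which computes the product of their matrices. -/
def comp {I : Type} {g d e : ℕ} :
    LinearCircuit F (Fin g) I d → LinearCircuit F J (Fin g) e → LinearCircuit F J I (e + d)
  | .last A, D => .cons A D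
  | .cons A C, D => .cons A (C.comp D)

/-- One copy of the circuit for every element of `X`, which computes the Kronecker product with
the identity matrix. -/
noncomputable def kroneckerOne [Semiring F] {I : Type} {d : ℕ} :
    LinearCircuit F J I d → (X : Type) → [Fintype X] → [DecidableEq X] →
      LinearCircuit F (J × X) (I × X) d
  | .last A, X, _, _ => .last (A ⊗ₖ (1 : Matrix X X F))
  | .cons (g := g) A C, X, _, _ =>
    let φ := (Fintype.equivFin (Fin g × X)).symm
    .cons ((A ⊗ₖ (1 : Matrix X X F)).submatrix (Equiv.refl _) φ)
      ((C.kroneckerOne X).reindex φ (Equiv.refl _))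

/-- The circuit for a Kronecker product that comes from `C ⊗ D = (C ⊗ 1) (1 ⊗ D)`. -/
noncomputable def kronecker [Semiring F] {I I' J J' : Type} [Fintype I'] [Fintype J]
    [DecidableEq I'] [DecidableEq J] {d e : ℕ} (C : LinearCircuit F J I d)
    (D : LinearCircuit F J' I' e) : LinearCircuit F (J × J') (I × I') (e + d) :=
  let φ := (Fintype.equivFin (J × I')).symm
  ((C.kroneckerOne I').reindex (Equiv.refl _) φ).comp
    ((D.kroneckerOne J).reindex (φ.trans (Equiv.prodComm _ _)) (Equiv.prodComm J J'))

theorem matrix_reindex [Semiring F] {I I' : Type} {d : ℕ} (C : LinearCircuit F J I d) (e : I' ≃ I)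
    (f : J' ≃ J) : (C.reindex e f).matrix = C.matrix.submatrix e f := by
  induction C generalizing I' with
  | last A => rfl
  | cons A C ih =>
    simp only [reindex, matrix, ih]
    exact Matrix.submatrix_mul_equiv A C.matrix e (Equiv.refl _) f

theorem size_reindex [Zero F] {I I' : Type} {d : ℕ} (C : LinearCircuit F J I d) (e : I' ≃ I)
    (f : J' ≃ J) : (C.reindex e f).size = C.size := by
  induction C generalizing I' with
  | last A => exact nnz_submatrix A e f
  | cons A C ih => simp only [reindex, size, ih, nnz_submatrix]

theorem matrix_comp [Semiring F] {I : Type} {g d e : ℕ} (C : LinearCircuit F (Fin g) I d)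
    (D : LinearCircuit F J (Fin g) e) : (C.comp D).matrix = C.matrix * D.matrix := by
  induction C with
  | last A => rfl
  | cons A C ih => simp only [comp, matrix, ih, Matrix.mul_assoc]

theorem size_comp [Zero F] {I : Type} {g d e : ℕ} (C : LinearCircuit F (Fin g) I d)
    (D : LinearCircuit F J (Fin g) e) : (C.comp D).size = C.size + D.size := by
  induction C with
  | last A => rfl
  | cons A C ih => simp only [comp, size, ih, add_assoc]

theorem matrix_kroneckerOne [CommSemiring F] {I : Type} {d : ℕ} (C : LinearCircuit F J I d)
    (X : Type) [Fintype X] [DecidableEq X] :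
    (C.kroneckerOne X).matrix = C.matrix ⊗ₖ (1 : Matrix X X F) := by
  induction C with
  | last A => rfl
  | cons A C ih =>
    simp only [kroneckerOne, matrix]
    rw [matrix_reindex, Matrix.submatrix_mul_equiv, ih, ← Matrix.mul_kronecker_mul, one_mul]
    rfl

theorem size_kroneckerOne [Semiring F] {I : Type} {d : ℕ} (C : LinearCircuit F J I d)
    (X : Type) [Fintype X] [DecidableEq X] :
    (C.kroneckerOne X).size = C.size * Fintype.card X := by
  rw [← Nat.card_eq_fintype_card]
  induction C with
  | last A => exact nnz_kronecker_one A
  | cons A C ih =>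
    simp only [kroneckerOne, size, size_reindex, ih, nnz_submatrix, nnz_kronecker_one, add_mul]

section Kronecker

variable {I I' J J' : Type} [Fintype I'] [Fintype J] [DecidableEq I'] [DecidableEq J] {d e : ℕ}

theorem matrix_kronecker [CommSemiring F] (C : LinearCircuit F J I d)
    (D : LinearCircuit F J' I' e) : (C.kronecker D).matrix = C.matrix ⊗ₖ D.matrix := by
  have hswap (φ : Fin (Fintype.card (J × I')) ≃ J × I') :
      (D.matrix ⊗ₖ (1 : Matrix J J F)).submatrix (φ.trans (Equiv.prodComm J I'))
        (Equiv.prodComm J J') = ((1 : Matrix J J F) ⊗ₖ D.matrix).submatrix φ (Equiv.refl _) := by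
    ext x ⟨j, j'⟩
    simp only [Matrix.submatrix_apply, Matrix.kroneckerMap_apply, mul_comm]
    rfl
  simp only [kronecker, matrix_comp, matrix_reindex, matrix_kroneckerOne]
  rw [hswap, Matrix.submatrix_mul_equiv, ← Matrix.mul_kronecker_mul, Matrix.mul_one,
    Matrix.one_mul]
  rfl

theorem size_kronecker [Semiring F] (C : LinearCircuit F J I d) (D : LinearCircuit F J' I' e) :
    (C.kronecker D).size = C.size * Fintype.card I' + D.size * Fintype.card J := by
  simp only [kronecker, size_comp, size_reindex, size_kroneckerOne]

end Kronecker

end LinearCircuit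

/-- The matrix `M` is computed by a linear circuit of depth `d` and of size at most `s`. -/
def HasCircuit {F J : Type*} [Semiring F] {I : Type} (M : Matrix I J F) (d : ℕ) (s : ℝ) : Prop :=
  ∃ C : LinearCircuit F J I d, C.matrix = M ∧ (C.size : ℝ) ≤ s

namespace HasCircuit

theorem mono {F J : Type*} [Semiring F] {I : Type} {M : Matrix I J F} {d : ℕ} {s t : ℝ}
    (h : HasCircuit M d s) (hst : s ≤ t) : HasCircuit M d t := by
  obtain ⟨C, hC, hs⟩ := h
  exact ⟨C, hC, hs.trans hst⟩

variable {F : Type*} [CommSemiring F] {I : Type} [Fintype I] {M : Matrix I I F}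

theorem kroneckerPower_add {a b d e : ℕ} {s t : ℝ} (ha : HasCircuit (kroneckerPower M a) d s)
    (hb : HasCircuit (kroneckerPower M b) e t) :
    HasCircuit (kroneckerPower M (a + b)) (e + d)
      (s * Fintype.card I ^ b + t * Fintype.card I ^ a) := by
  classical
  obtain ⟨C, hC, hCs⟩ := ha
  obtain ⟨D, hD, hDs⟩ := hb
  refine ⟨(C.kronecker D).reindex (Fin.appendEquiv a b).symm (Fin.appendEquiv a b).symm, ?_, ?_⟩
  · rw [LinearCircuit.matrix_reindex, LinearCircuit.matrix_kronecker, hC, hD,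
      ← kroneckerPower_append]
    simp
  · rw [LinearCircuit.size_reindex, LinearCircuit.size_kronecker]
    simp only [Fintype.card_pi_const, Nat.cast_add, Nat.cast_mul, Nat.cast_pow]
    gcongr

theorem kroneckerPower_of_le_mul {d m : ℕ} {B : ℝ}
    (hM : ∀ k ≤ m, HasCircuit (kroneckerPower M k) d (B * Fintype.card I ^ k)) {h k : ℕ}
    (hh : 1 ≤ h) (hk : k ≤ h * m) :
    HasCircuit (kroneckerPower M k) (d * h) (h * B * Fintype.card I ^ k) := by
  induction h, hh using Nat.le_induction generalizing k with
  | base => simpa using hM k (by simpa using hk)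
  | succ h _ ih =>
    obtain ⟨a, b, rfl, ha, hb⟩ : ∃ a b, k = a + b ∧ a ≤ m ∧ b ≤ h * m :=
      ⟨min k m, k - min k m, by lia, min_le_right _ _, by rw [add_mul] at hk; lia⟩
    refine (kroneckerPower_add (hM a ha) (ih hb)).mono (le_of_eq ?_)
    push_cast
    ring

/-- Cut `k` into `h` blocks of length at most `⌈k / h⌉`; the factor `q ^ β` pays for rounding. -/
theorem kroneckerPower_mul_depth [Nonempty I] {d : ℕ} {K β : ℝ} (hK : 0 ≤ K) (hβ : 0 ≤ β)
    (hM : ∀ k, HasCircuit (kroneckerPower M k) d (K * ((Fintype.card I : ℝ) ^ k) ^ (1 + β)))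
    {h : ℕ} (hh : 1 ≤ h) (k : ℕ) :
    HasCircuit (kroneckerPower M k) (d * h)
      (h * K * Fintype.card I ^ β * ((Fintype.card I : ℝ) ^ k) ^ (1 + β / h)) := by
  set q : ℝ := (Fintype.card I : ℝ)
  have hq : 1 ≤ q := Nat.one_le_cast.2 Fintype.card_pos
  have hq₀ : 0 < q := zero_lt_one.trans_le hq
  have hpow (n : ℕ) (x : ℝ) : (q ^ n) ^ (1 + x) = q ^ n * q ^ (n * x) := by
    rw [Real.rpow_add (by positivity), Real.rpow_one, ← Real.rpow_natCast_mul hq₀.le]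
  have hround : ((⌈(k : ℝ) / h⌉₊ : ℕ) : ℝ) ≤ k / h + 1 := (Nat.ceil_lt_add_one (by positivity)).le
  have hblock : k ≤ h * ⌈(k : ℝ) / h⌉₊ := by
    have hceil := (div_le_iff₀' (by positivity : (0 : ℝ) < h)).1 (Nat.le_ceil ((k : ℝ) / h))
    exact_mod_cast hceil
  refine (kroneckerPower_of_le_mul (B := K * q ^ β * q ^ (k * (β / h))) (fun j hj => ?_) hh
    hblock).mono (le_of_eq (by rw [hpow]; ring))
  refine (hM j).mono ?_
  have hj' : (j : ℝ) * β ≤ β + k * (β / h) := calc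
    (j : ℝ) * β ≤ (k / h + 1) * β := by
      gcongr
      exact (Nat.cast_le.2 hj).trans hround
    _ = β + k * (β / h) := by ring
  calc K * (q ^ j) ^ (1 + β) = K * q ^ j * q ^ (j * β) := by rw [hpow]; ring
    _ ≤ K * q ^ j * q ^ (β + k * (β / h)) := by gcongr
    _ = K * q ^ β * q ^ (k * (β / h)) * q ^ j := by rw [Real.rpow_add hq₀]; ring

end HasCircuit

/-! ### Operations on partitionings -/

section Partitioning

variable {I J I' J' : Type*}

theorem kroneckerPower_apply_le_one {M : Matrix I J ℕ} (hM : ∀ i j, M i j ≤ 1) (n : ℕ)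
    (i : Fin n → I) (j : Fin n → J) : kroneckerPower M n i j ≤ 1 :=
  Finset.prod_le_one' (s := Finset.univ) fun t _ => hM (i t) (j t)

/-- The number of rectangles of a family that contain the entry `(i, j)`. -/
def coverCount [DecidableEq I] [DecidableEq J] (P : Multiset (Rectangle I J)) (i : I) (j : J) : ℕ :=
  (P.map fun Q => if i ∈ Q.1 ∧ j ∈ Q.2 then 1 else 0).sum

/-- The total number `∑ (|I_i| + |J_i|)` of rows and columns, whose minimum over the partitionings
of `M` is `sizePAR M`. -/
def rectSize (P : Multiset (Rectangle I J)) : ℕ :=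
  (P.map fun Q => Q.1.card + Q.2.card).sum

namespace Rectangle

/-- The product of two rectangles, for the Kronecker product of matrices. -/
def prod (Q : Rectangle I J) (Q' : Rectangle I' J') : Rectangle (I × I') (J × J') :=
  (Q.1 ×ˢ Q'.1, Q.2 ×ˢ Q'.2)

/-- The rectangle with its rows and columns renamed along bijections. -/
def map (e : I ≃ I') (f : J ≃ J') (Q : Rectangle I J) : Rectangle I' J' :=
  (Q.1.map e.toEmbedding, Q.2.map f.toEmbedding)

/-- The product of a rectangle of the `m`-th and one of the `n`-th Kronecker power, as a rectangle
of the `(m + n)`-th power. -/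
def append {m n : ℕ} (Q : Rectangle (Fin m → I) (Fin m → J))
    (Q' : Rectangle (Fin n → I) (Fin n → J)) : Rectangle (Fin (m + n) → I) (Fin (m + n) → J) :=
  (prod Q Q').map (Fin.appendEquiv m n) (Fin.appendEquiv m n)

variable {m n : ℕ} (Q : Rectangle (Fin m → I) (Fin m → J)) (Q' : Rectangle (Fin n → I) (Fin n → J))

theorem card_append_fst : (append Q Q').1.card = Q.1.card * Q'.1.card := by
  simp [append, map, prod]

theorem card_append_snd : (append Q Q').2.card = Q.2.card * Q'.2.card := by
  simp [append, map, prod]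

end Rectangle

section DecidableEq

variable [DecidableEq I] [DecidableEq J] [DecidableEq I'] [DecidableEq J']

theorem coverCount_add (P P' : Multiset (Rectangle I J)) (i : I) (j : J) :
    coverCount (P + P') i j = coverCount P i j + coverCount P' i j := by
  simp [coverCount]

theorem coverCount_map {ι : Type*} (s : Multiset ι) (f : ι → Rectangle I J) (i : I) (j : J) :
    coverCount (s.map f) i j =
      (s.map fun x => if i ∈ (f x).1 ∧ j ∈ (f x).2 then 1 else 0).sum := by
  rw [coverCount, Multiset.map_map]
  rfl

theorem coverCount_bind {ι : Type*} (s : Multiset ι) (f : ι → Multiset (Rectangle I J)) (i : I)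
    (j : J) : coverCount (s.bind f) i j = (s.map fun x => coverCount (f x) i j).sum := by
  rw [coverCount, Multiset.map_bind, Multiset.sum_bind]
  rfl

theorem coverCount_le_rectSize (P : Multiset (Rectangle I J)) (i : I) (j : J) :
    coverCount P i j ≤ rectSize P := by
  refine Multiset.sum_map_le_sum_map _ _ fun Q _ => ?_
  split_ifs with h
  · exact (Finset.card_pos.2 ⟨i, h.1⟩).trans_le (Nat.le_add_right _ _)
  · exact Nat.zero_le _

namespace IsPartitioning

theorem bind_prod {M : Matrix I J ℕ} {N : Matrix I' J' ℕ} {P : Multiset (Rectangle I J)}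
    {T : Rectangle I J → Multiset (Rectangle I' J')} (hP : IsPartitioning P M)
    (hT : ∀ Q, IsPartitioning (T Q) N) :
    IsPartitioning (P.bind fun Q => (T Q).map (Rectangle.prod Q)) (M ⊗ₖ N) := by
  rintro ⟨i, i'⟩ ⟨j, j'⟩
  change coverCount _ _ _ = M i j * N i' j'
  rw [coverCount_bind, ← hP i j, ← Multiset.sum_map_mul_right]
  refine congrArg _ (Multiset.map_congr rfl fun Q _ => ?_)
  rw [coverCount_map, ← hT Q i' j', ← Multiset.sum_map_mul_left]
  refine congrArg _ (Multiset.map_congr rfl fun Q' _ => ?_)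
  simp only [Rectangle.prod, Finset.mem_product, mul_ite, mul_one, mul_zero, ← ite_and]
  exact if_congr (by tauto) rfl rfl

theorem map {M : Matrix I J ℕ} {P : Multiset (Rectangle I J)} (hP : IsPartitioning P M)
    (e : I ≃ I') (f : J ≃ J') :
    IsPartitioning (P.map (Rectangle.map e f)) (M.submatrix e.symm f.symm) := by
  intro i j
  change coverCount _ _ _ = M (e.symm i) (f.symm j)
  rw [← hP, coverCount_map]
  simp only [Rectangle.map, Finset.mem_map_equiv]

theorem bind_append {M : Matrix I J ℕ} {m n : ℕ} {P : Multiset (Rectangle (Fin m → I) (Fin m → J))}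
    {T : Rectangle (Fin m → I) (Fin m → J) → Multiset (Rectangle (Fin n → I) (Fin n → J))}
    (hP : IsPartitioning P (kroneckerPower M m))
    (hT : ∀ Q, IsPartitioning (T Q) (kroneckerPower M n)) :
    IsPartitioning (P.bind fun Q => (T Q).map (Rectangle.append Q)) (kroneckerPower M (m + n)) := by
  have h := (hP.bind_prod hT).map (Fin.appendEquiv m n) (Fin.appendEquiv m n)
  rw [← kroneckerPower_append, Matrix.submatrix_submatrix, Multiset.map_bind] at h
  simp only [Multiset.map_map, Equiv.self_comp_symm, Matrix.submatrix_id_id] at h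
  exact h

theorem hasCircuit {F : Type*} [Semiring F] {I J : Type} [DecidableEq I] [DecidableEq J]
    {P : Multiset (Rectangle I J)} {M : Matrix I J ℕ} (hP : IsPartitioning P M) :
    HasCircuit (M.map (Nat.castRingHom F)) 2 (rectSize P) := by
  induction P using Quot.inductionOn with | _ L
  let A : Matrix I (Fin L.length) F := .of fun i t => if i ∈ L[t].1 then 1 else 0
  let B : Matrix J (Fin L.length) F := .of fun j t => if j ∈ L[t].2 then 1 else 0
  refine ⟨.cons A (.last B.transpose), ?_, Nat.cast_le.2 ?_⟩
  · ext i j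
    rw [Matrix.map_apply, ← hP i j, LinearCircuit.matrix, LinearCircuit.matrix, Matrix.mul_apply]
    simp only [Multiset.quot_mk_to_coe'', Multiset.map_coe, Multiset.sum_coe,
      ← Fin.sum_univ_fun_getElem, map_sum]
    refine Finset.sum_congr rfl fun t _ => ?_
    simp only [A, B, Matrix.of_apply, Matrix.transpose_apply, mul_ite, mul_one, mul_zero, ← ite_and,
      apply_ite (Nat.castRingHom F), map_one, map_zero]
    exact if_congr and_comm rfl rfl
  · simp only [LinearCircuit.size, nnz_transpose, rectSize, Multiset.quot_mk_to_coe'',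
      Multiset.map_coe, Multiset.sum_coe, ← Fin.sum_univ_fun_getElem, Finset.sum_add_distrib]
    exact add_le_add (nnz_indicator_le _) (nnz_indicator_le _)

end IsPartitioning

/-- The partitioning of a `0/1` matrix into its rows. -/
def rowPartitioning [Fintype I] [Fintype J] (M : Matrix I J ℕ) : Multiset (Rectangle I J) :=
  Finset.univ.val.map fun i => ({i}, Finset.univ.filter fun j => M i j = 1)

theorem isPartitioning_rowPartitioning [Fintype I] [Fintype J] {M : Matrix I J ℕ}
    (hM : ∀ i j, M i j ≤ 1) : IsPartitioning (rowPartitioning M) M := by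
  intro i j
  calc coverCount (rowPartitioning M) i j
      = ∑ i', if i ∈ ({i'} : Finset I) ∧ j ∈ Finset.univ.filter (M i' · = 1) then 1 else 0 :=
        coverCount_map _ _ i j
    _ = if M i j = 1 then 1 else 0 := by simp [ite_and]
    _ = M i j := by have := hM i j; split_ifs <;> lia

/-! ### Existence of the asymptotic partitioning size -/

theorem IsPartitioning.sizePAR_le {M : Matrix I J ℕ} {P : Multiset (Rectangle I J)}
    (hP : IsPartitioning P M) : sizePAR M ≤ rectSize P :=
  Nat.sInf_le ⟨P, hP, rfl⟩

section Finite

variable [Finite I] [Finite J] {M : Matrix I J ℕ}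

theorem exists_isPartitioning_sizePAR (hM : ∀ i j, M i j ≤ 1) :
    ∃ P, IsPartitioning P M ∧ rectSize P = sizePAR M := by
  cases nonempty_fintype I
  cases nonempty_fintype J
  exact Nat.sInf_mem (s := {s | ∃ P, IsPartitioning P M ∧ rectSize P = s})
    ⟨_, rowPartitioning M, isPartitioning_rowPartitioning hM, rfl⟩

theorem apply_le_sizePAR (hM : ∀ i j, M i j ≤ 1) (i : I) (j : J) : M i j ≤ sizePAR M := by
  obtain ⟨P, hP, hs⟩ := exists_isPartitioning_sizePAR hM
  exact hs ▸ hP i j ▸ coverCount_le_rectSize P i j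

theorem sizePAR_kroneckerPower_add_le (hM : ∀ i j, M i j ≤ 1) (m n : ℕ) :
    sizePAR (kroneckerPower M (m + n)) ≤
      sizePAR (kroneckerPower M m) * sizePAR (kroneckerPower M n) := by
  obtain ⟨P, hP, hs⟩ := exists_isPartitioning_sizePAR (kroneckerPower_apply_le_one hM m)
  obtain ⟨P', hP', hs'⟩ := exists_isPartitioning_sizePAR (kroneckerPower_apply_le_one hM n)
  refine (hP.bind_append fun _ => hP').sizePAR_le.trans ?_
  rw [← hs, ← hs', rectSize, Multiset.map_bind, Multiset.sum_bind, rectSize,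
    ← Multiset.sum_map_mul_right]
  refine Multiset.sum_map_le_sum_map _ _ fun Q _ => ?_
  rw [Multiset.map_map, rectSize, ← Multiset.sum_map_mul_left]
  refine Multiset.sum_map_le_sum_map _ _ fun Q' _ => ?_
  simp only [Function.comp_apply, Rectangle.card_append_fst, Rectangle.card_append_snd]
  nlinarith only [Nat.zero_le (Q.1.card * Q'.2.card), Nat.zero_le (Q.2.card * Q'.1.card)]

theorem sizePAR_kroneckerPower_pos (hM : ∀ i j, M i j ≤ 1) {i : I} {j : J} (hij : M i j ≠ 0)
    (n : ℕ) : 0 < sizePAR (kroneckerPower M n) :=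
  (Finset.prod_pos (s := Finset.univ) (f := fun _ : Fin n => M i j)
    fun _ _ => Nat.pos_of_ne_zero hij).trans_le
      (apply_le_sizePAR (kroneckerPower_apply_le_one hM n) (fun _ => i) fun _ => j)

theorem subadditive_log_sizePAR (hM : ∀ i j, M i j ≤ 1) {i : I} {j : J} (hij : M i j ≠ 0) :
    Subadditive fun n => Real.log (sizePAR (kroneckerPower M n)) := by
  intro m n
  have hpos (n : ℕ) : (0 : ℝ) < sizePAR (kroneckerPower M n) :=
    Nat.cast_pos.2 (sizePAR_kroneckerPower_pos hM hij n)
  rw [← Real.log_mul (hpos m).ne' (hpos n).ne']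
  exact Real.log_le_log (hpos _) (mod_cast sizePAR_kroneckerPower_add_le hM m n)

theorem tendsto_sizePAR_rpow_sigmaPAR (hM : ∀ i j, M i j ≤ 1) {i : I} {j : J} (hij : M i j ≠ 0) :
    Tendsto (fun n : ℕ => (sizePAR (kroneckerPower M n) : ℝ) ^ (1 / (n : ℝ))) atTop
      (𝓝 (sigmaPAR M)) := by
  have hsub := subadditive_log_sizePAR hM hij
  have hbdd : BddBelow (Set.range fun n : ℕ => Real.log (sizePAR (kroneckerPower M n)) / n) :=
    ⟨0, by rintro _ ⟨n, rfl⟩; positivity⟩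
  have hexp : Tendsto (fun n : ℕ => (sizePAR (kroneckerPower M n) : ℝ) ^ (1 / (n : ℝ))) atTop
      (𝓝 (Real.exp hsub.lim)) := by
    refine ((Real.continuous_exp.tendsto _).comp (hsub.tendsto_lim hbdd)).congr fun n => ?_
    rw [Function.comp_apply,
      Real.rpow_def_of_pos (Nat.cast_pos.2 (sizePAR_kroneckerPower_pos hM hij n)), mul_one_div]
  rw [sigmaPAR, hexp.limUnder_eq]
  exact hexp

end Finite

end DecidableEq

end Partitioning

/-! ### Balancing rectangles with a potential function -/

/-- The `ε`-power sum norm of the pair `(a, b)`, a smooth majorant of `max a b`. -/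
noncomputable def powNorm (ε a b : ℝ) : ℝ := (a ^ ε + b ^ ε) ^ ε⁻¹

/-- The share of `a` in the `ε`-power sum of `a` and `b`; it is `0` if `a = b = 0`. -/
noncomputable def powWeight (ε a b : ℝ) : ℝ := a ^ ε / (a ^ ε + b ^ ε)

theorem powNorm_comm (ε a b : ℝ) : powNorm ε a b = powNorm ε b a := by
  rw [powNorm, powNorm, add_comm]

theorem powNorm_nonneg {ε a b : ℝ} (ha : 0 ≤ a) (hb : 0 ≤ b) : 0 ≤ powNorm ε a b := by
  unfold powNorm
  positivity

theorem le_powNorm_left {ε a b : ℝ} (hε : 0 < ε) (ha : 0 ≤ a) (hb : 0 ≤ b) :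
    a ≤ powNorm ε a b := calc
  a = (a ^ ε) ^ ε⁻¹ := (Real.rpow_rpow_inv ha hε.ne').symm
  _ ≤ powNorm ε a b := by
    unfold powNorm
    gcongr
    exact le_add_of_nonneg_right (Real.rpow_nonneg hb _)

theorem le_powNorm_right {ε a b : ℝ} (hε : 0 < ε) (ha : 0 ≤ a) (hb : 0 ≤ b) :
    b ≤ powNorm ε a b :=
  (le_powNorm_left hε hb ha).trans_eq (powNorm_comm ε b a)

theorem powWeight_mem_Icc {a b : ℝ} (ε : ℝ) (ha : 0 ≤ a) (hb : 0 ≤ b) :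
    powWeight ε a b ∈ Set.Icc 0 1 := by
  have ha' := Real.rpow_nonneg ha ε
  have hb' := Real.rpow_nonneg hb ε
  exact ⟨div_nonneg ha' (add_nonneg ha' hb'), div_le_one_of_le₀ (by linarith) (by linarith)⟩

theorem rpow_le_one_add_mul_log {ε B z : ℝ} (hε : 0 ≤ ε) (hB : ε * B ≤ 1) (hz : 1 ≤ z)
    (hzB : Real.log z ≤ B) : z ^ ε ≤ 1 + ε * Real.log z + (ε * B) ^ 2 := by
  have hlog : 0 ≤ Real.log z := Real.log_nonneg hz
  have hle : ε * Real.log z ≤ ε * B := by gcongr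
  have hexp := Real.abs_exp_sub_one_sub_id_le (x := ε * Real.log z)
    (by rw [abs_of_nonneg (by positivity)]; linarith)
  have hsq : (ε * Real.log z) ^ 2 ≤ (ε * B) ^ 2 := by gcongr
  rw [Real.rpow_def_of_pos (by linarith), mul_comm]
  linarith [(abs_le.1 hexp).2]

theorem powerMean_le_exp_mul_geomMean {ε B p x y : ℝ} (hε : 0 < ε) (hB : ε * B ≤ 1)
    (hp : p ∈ Set.Icc (0 : ℝ) 1) (hx : 1 ≤ x) (hy : 1 ≤ y) (hxB : Real.log x ≤ B)
    (hyB : Real.log y ≤ B) :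
    (p * x ^ ε + (1 - p) * y ^ ε) ^ ε⁻¹ ≤ Real.exp (ε * B ^ 2) * (x ^ p * y ^ (1 - p)) := by
  obtain ⟨hp₀, hp₁⟩ := hp
  have : 0 ≤ 1 - p := sub_nonneg.2 hp₁
  have hx₀ : 0 < x := zero_lt_one.trans_le hx
  have hy₀ : 0 < y := zero_lt_one.trans_le hy
  have hmean : p * x ^ ε + (1 - p) * y ^ ε ≤
      Real.exp ((ε * B ^ 2 + (Real.log x * p + Real.log y * (1 - p))) * ε) := calc
    p * x ^ ε + (1 - p) * y ^ ε
      ≤ p * (1 + ε * Real.log x + (ε * B) ^ 2) + (1 - p) * (1 + ε * Real.log y + (ε * B) ^ 2) := by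
        gcongr
        · exact rpow_le_one_add_mul_log hε.le hB hx hxB
        · exact rpow_le_one_add_mul_log hε.le hB hy hyB
    _ = (ε * B ^ 2 + (Real.log x * p + Real.log y * (1 - p))) * ε + 1 := by ring
    _ ≤ _ := Real.add_one_le_exp _
  calc (p * x ^ ε + (1 - p) * y ^ ε) ^ ε⁻¹
      ≤ Real.exp ((ε * B ^ 2 + (Real.log x * p + Real.log y * (1 - p))) * ε) ^ ε⁻¹ := by gcongr
    _ = Real.exp (ε * B ^ 2) * (x ^ p * y ^ (1 - p)) := by
        rw [Real.exp_mul, Real.rpow_rpow_inv (Real.exp_pos _).le hε.ne', Real.exp_add,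
          Real.exp_add, Real.rpow_def_of_pos hx₀, Real.rpow_def_of_pos hy₀]

/-- Multiplying the sides of a rectangle by `x` and `y` multiplies its potential by the geometric
mean of `x` and `y` with the weights of its sides, up to a factor that tends to `1` with `ε`. -/
theorem powNorm_mul_le {ε B a b x y : ℝ} (hε : 0 < ε) (hB : ε * B ≤ 1) (ha : 0 ≤ a) (hb : 0 ≤ b)
    (hx : 1 ≤ x) (hy : 1 ≤ y) (hxB : Real.log x ≤ B) (hyB : Real.log y ≤ B) :
    powNorm ε (a * x) (b * y) ≤ powNorm ε a b *
      (Real.exp (ε * B ^ 2) * (x ^ powWeight ε a b * y ^ (1 - powWeight ε a b))) := by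
  have hsum : 0 ≤ a ^ ε + b ^ ε := add_nonneg (Real.rpow_nonneg ha _) (Real.rpow_nonneg hb _)
  set p := powWeight ε a b
  have hp_mem : p ∈ Set.Icc 0 1 := powWeight_mem_Icc ε ha hb
  have hpa : p * (a ^ ε + b ^ ε) = a ^ ε := div_mul_cancel_of_imp fun h =>
    ((add_eq_zero_iff_of_nonneg (Real.rpow_nonneg ha _) (Real.rpow_nonneg hb _)).1 h).1
  have hsplit : (a * x) ^ ε + (b * y) ^ ε =
      (a ^ ε + b ^ ε) * (p * x ^ ε + (1 - p) * y ^ ε) := by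
    rw [Real.mul_rpow ha (by positivity), Real.mul_rpow hb (by positivity)]
    linear_combination (y ^ ε - x ^ ε) * hpa
  have hmean : 0 ≤ p * x ^ ε + (1 - p) * y ^ ε :=
    add_nonneg (mul_nonneg hp_mem.1 (by positivity))
      (mul_nonneg (sub_nonneg.2 hp_mem.2) (by positivity))
  rw [powNorm, hsplit, Real.mul_rpow hsum hmean]
  exact mul_le_mul_of_nonneg_left (powerMean_le_exp_mul_geomMean hε hB hp_mem hx hy hxB hyB)
    (powNorm_nonneg ha hb)

section Potential

variable {I J : Type*}

theorem alphaVolume_nonneg (P : Multiset (Rectangle I J)) (p : ℝ) : 0 ≤ alphaVolume P p := by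
  refine Multiset.sum_nonneg fun v hv => ?_
  obtain ⟨Q, -, rfl⟩ := Multiset.mem_map.1 hv
  positivity

theorem alphaVolume_add (P P' : Multiset (Rectangle I J)) (p : ℝ) :
    alphaVolume (P + P') p = alphaVolume P p + alphaVolume P' p := by
  simp [alphaVolume]

/-- The sum of the power norms of the rectangles of a family. -/
noncomputable def rectPotential (ε : ℝ) (P : Multiset (Rectangle I J)) : ℝ :=
  (P.map fun Q => powNorm ε Q.1.card Q.2.card).sum

theorem rectSize_le_two_mul_rectPotential {ε : ℝ} (hε : 0 < ε) (P : Multiset (Rectangle I J)) :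
    (rectSize P : ℝ) ≤ 2 * rectPotential ε P := by
  rw [rectSize, Nat.cast_multiset_sum, Multiset.map_map, rectPotential, ← Multiset.sum_map_mul_left]
  refine Multiset.sum_map_le_sum_map _ _ fun Q _ => ?_
  have hrows := le_powNorm_left hε (Nat.cast_nonneg (α := ℝ) Q.1.card) (Nat.cast_nonneg Q.2.card)
  have hcols := le_powNorm_right hε (Nat.cast_nonneg (α := ℝ) Q.1.card) (Nat.cast_nonneg Q.2.card)
  simp only [Function.comp_apply, Nat.cast_add]
  linarith

variable [DecidableEq I] [DecidableEq J]

/-- For every exponent `p ∈ [0, 1]` the matrix has a partitioning of `p`-volume at most `V`. -/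
def HasVolumeBound (M : Matrix I J ℕ) (V : ℝ) : Prop :=
  ∀ p ∈ Set.Icc (0 : ℝ) 1, ∃ P, IsPartitioning P M ∧ alphaVolume P p ≤ V

theorem HasVolumeBound.nonneg {M : Matrix I J ℕ} {V : ℝ} (hM : HasVolumeBound M V) : 0 ≤ V := by
  obtain ⟨P, -, hP⟩ := hM 0 ⟨le_rfl, zero_le_one⟩
  exact (alphaVolume_nonneg P 0).trans hP

theorem IsPartitioning.exists_nonempty {M : Matrix I J ℕ} {P : Multiset (Rectangle I J)}
    (hP : IsPartitioning P M) (p : ℝ) :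
    ∃ P', IsPartitioning P' M ∧ (∀ Q ∈ P', Q.1.Nonempty ∧ Q.2.Nonempty) ∧
      alphaVolume P' p ≤ alphaVolume P p := by
  let IsNonempty (Q : Rectangle I J) : Prop := Q.1.Nonempty ∧ Q.2.Nonempty
  refine ⟨P.filter IsNonempty, fun i j => ?_, fun Q hQ => (Multiset.mem_filter.1 hQ).2, ?_⟩
  · have hempty : coverCount (P.filter (¬ IsNonempty ·)) i j = 0 := by
      refine Multiset.sum_eq_zero fun v hv => ?_
      obtain ⟨Q, hQ, rfl⟩ := Multiset.mem_map.1 hv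
      exact if_neg fun h => (Multiset.mem_filter.1 hQ).2 ⟨⟨i, h.1⟩, ⟨j, h.2⟩⟩
    calc coverCount (P.filter IsNonempty) i j
        = coverCount (P.filter IsNonempty + P.filter (¬ IsNonempty ·)) i j := by
          rw [coverCount_add, hempty, add_zero]
      _ = M i j := by rw [Multiset.filter_add_not]; exact hP i j
  · calc alphaVolume (P.filter IsNonempty) p
        ≤ alphaVolume (P.filter IsNonempty) p + alphaVolume (P.filter (¬ IsNonempty ·)) p :=
          le_add_of_nonneg_right (alphaVolume_nonneg _ p)
      _ = alphaVolume P p := by rw [← alphaVolume_add, Multiset.filter_add_not]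

section Refinement

variable [Fintype I] [Fintype J] {M : Matrix I J ℕ} {d : ℕ} {V ε B : ℝ}

theorem log_card_le_log_card_univ {L : Type*} [Fintype L] {S : Finset L} (hS : S.Nonempty) :
    Real.log S.card ≤ Real.log (Fintype.card L) :=
  Real.log_le_log (mod_cast hS.card_pos) (mod_cast S.card_le_univ)

theorem HasVolumeBound.exists_refine_rectangle (hM : HasVolumeBound (kroneckerPower M d) V)
    (hε : 0 < ε) (hB : ε * B ≤ 1) (hI : Real.log (Fintype.card (Fin d → I)) ≤ B)
    (hJ : Real.log (Fintype.card (Fin d → J)) ≤ B) {m : ℕ}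
    (Q : Rectangle (Fin m → I) (Fin m → J)) :
    ∃ T, IsPartitioning T (kroneckerPower M d) ∧ rectPotential ε (T.map Q.append) ≤
      Real.exp (ε * B ^ 2) * V * powNorm ε Q.1.card Q.2.card := by
  set a : ℝ := (Q.1.card : ℝ)
  set b : ℝ := (Q.2.card : ℝ)
  have ha : 0 ≤ a := Nat.cast_nonneg _
  have hb : 0 ≤ b := Nat.cast_nonneg _
  obtain ⟨P, hP, hPV⟩ := hM _ (powWeight_mem_Icc ε ha hb)
  obtain ⟨T, hT, hTne, hTP⟩ := hP.exists_nonempty (powWeight ε a b)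
  refine ⟨T, hT, ?_⟩
  calc rectPotential ε (T.map Q.append)
      ≤ (T.map fun Q' => powNorm ε a b * Real.exp (ε * B ^ 2) *
          ((Q'.1.card : ℝ) ^ powWeight ε a b * (Q'.2.card : ℝ) ^ (1 - powWeight ε a b))).sum := by
        rw [rectPotential, Multiset.map_map]
        refine Multiset.sum_map_le_sum_map _ _ fun Q' hQ' => ?_
        obtain ⟨hrows, hcols⟩ := hTne Q' hQ'
        rw [Function.comp_apply, Rectangle.card_append_fst, Rectangle.card_append_snd, Nat.cast_mul,
          Nat.cast_mul, mul_assoc]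
        exact powNorm_mul_le hε hB ha hb (mod_cast hrows.card_pos) (mod_cast hcols.card_pos)
          ((log_card_le_log_card_univ hrows).trans hI) ((log_card_le_log_card_univ hcols).trans hJ)
    _ = powNorm ε a b * Real.exp (ε * B ^ 2) * alphaVolume T (powWeight ε a b) := by
        rw [Multiset.sum_map_mul_left, alphaVolume]
    _ ≤ powNorm ε a b * Real.exp (ε * B ^ 2) * V := by
        have := powNorm_nonneg (ε := ε) ha hb
        gcongr
        exact hTP.trans hPV
    _ = Real.exp (ε * B ^ 2) * V * powNorm ε a b := by ring

theorem HasVolumeBound.exists_refine (hM : HasVolumeBound (kroneckerPower M d) V)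
    (hε : 0 < ε) (hB : ε * B ≤ 1) (hI : Real.log (Fintype.card (Fin d → I)) ≤ B)
    (hJ : Real.log (Fintype.card (Fin d → J)) ≤ B) {m : ℕ}
    {P : Multiset (Rectangle (Fin m → I) (Fin m → J))}
    (hP : IsPartitioning P (kroneckerPower M m)) :
    ∃ P', IsPartitioning P' (kroneckerPower M (m + d)) ∧
      rectPotential ε P' ≤ Real.exp (ε * B ^ 2) * V * rectPotential ε P := by
  choose T hT hTV using fun Q : Rectangle (Fin m → I) (Fin m → J) =>
    hM.exists_refine_rectangle hε hB hI hJ Q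
  refine ⟨_, hP.bind_append hT, ?_⟩
  rw [rectPotential, Multiset.map_bind, Multiset.sum_bind, rectPotential,
    ← Multiset.sum_map_mul_left]
  exact Multiset.sum_map_le_sum_map _ _ fun Q _ => hTV Q

theorem HasVolumeBound.exists_rectPotential_le (hM : HasVolumeBound (kroneckerPower M d) V)
    (hε : 0 < ε) (hB : ε * B ≤ 1) (hI : Real.log (Fintype.card (Fin d → I)) ≤ B)
    (hJ : Real.log (Fintype.card (Fin d → J)) ≤ B) (n : ℕ) :
    ∃ P, IsPartitioning P (kroneckerPower M (d * n)) ∧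
      rectPotential ε P ≤ 2 ^ ε⁻¹ * (Real.exp (ε * B ^ 2) * V) ^ n := by
  induction n with
  | zero =>
    rw [Nat.mul_zero]
    refine ⟨{({Fin.elim0}, {Fin.elim0})}, fun i j => ?_, ?_⟩
    · simp [kroneckerPower, Subsingleton.elim i Fin.elim0, Subsingleton.elim j Fin.elim0]
    · simp [rectPotential, powNorm, one_add_one_eq_two]
  | succ n ih =>
    obtain ⟨P, hP, hPV⟩ := ih
    obtain ⟨P', hP', hPV'⟩ := hM.exists_refine hε hB hI hJ hP
    have hV := hM.nonneg
    refine ⟨P', hP', hPV'.trans ?_⟩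
    calc Real.exp (ε * B ^ 2) * V * rectPotential ε P
        ≤ Real.exp (ε * B ^ 2) * V * (2 ^ ε⁻¹ * (Real.exp (ε * B ^ 2) * V) ^ n) := by gcongr
      _ = 2 ^ ε⁻¹ * (Real.exp (ε * B ^ 2) * V) ^ (n + 1) := by ring

end Refinement

theorem le_rpow_of_tendsto_of_forall_le {f : ℕ → ℝ} {l C W : ℝ} {d : ℕ}
    (hf : Tendsto (fun n : ℕ => f n ^ (1 / (n : ℝ))) atTop (𝓝 l)) (hf₀ : ∀ n, 0 ≤ f n) (hd : 0 < d)
    (hC : 0 < C) (hW : 0 ≤ W) (h : ∀ n, f (d * n) ≤ C * W ^ n) : l ≤ W ^ (1 / (d : ℝ)) := by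
  have hsub : Tendsto (fun n : ℕ => d * n) atTop atTop := tendsto_id.const_mul_atTop' hd
  have hconst : Tendsto (fun n : ℕ => C ^ (1 / ((d * n : ℕ) : ℝ))) atTop (𝓝 1) := by
    simpa using tendsto_const_nhds.rpow (tendsto_one_div_atTop_nhds_zero_nat.comp hsub)
      (Or.inl hC.ne')
  have hbound : Tendsto (fun n : ℕ => C ^ (1 / ((d * n : ℕ) : ℝ)) * W ^ (1 / (d : ℝ))) atTop
      (𝓝 (W ^ (1 / (d : ℝ)))) := by
    simpa using hconst.mul_const (W ^ (1 / (d : ℝ)))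
  refine le_of_tendsto_of_tendsto (hf.comp hsub) hbound ?_
  filter_upwards [eventually_gt_atTop 0] with n hn
  calc f (d * n) ^ (1 / ((d * n : ℕ) : ℝ)) ≤ (C * W ^ n) ^ (1 / ((d * n : ℕ) : ℝ)) := by
        gcongr
        exacts [hf₀ _, h n]
    _ = C ^ (1 / ((d * n : ℕ) : ℝ)) * W ^ (1 / (d : ℝ)) := by
        rw [Real.mul_rpow hC.le (by positivity), ← Real.rpow_natCast_mul hW]
        congr 2
        push_cast
        field_simp

/-- The potential grows by at most a factor `exp (ε B²) V` for every `d` levels, with `B`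
independent of `ε`; let `ε` tend to `0`. -/
theorem HasVolumeBound.sigmaPAR_le [Finite I] [Finite J] {M : Matrix I J ℕ} {d : ℕ} {V : ℝ}
    (hV : HasVolumeBound (kroneckerPower M d) V) (hM : ∀ i j, M i j ≤ 1) {i : I} {j : J}
    (hij : M i j ≠ 0) (hd : 0 < d) : sigmaPAR M ≤ V ^ (1 / (d : ℝ)) := by
  cases nonempty_fintype I
  cases nonempty_fintype J
  obtain ⟨B, hI, hJ⟩ : ∃ B : ℝ, Real.log (Fintype.card (Fin d → I)) ≤ B ∧
      Real.log (Fintype.card (Fin d → J)) ≤ B := ⟨_, le_max_left _ _, le_max_right _ _⟩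
  have hbound {ε : ℝ} (hε : 0 < ε) (hB : ε * B ≤ 1) :
      sigmaPAR M ≤ (Real.exp (ε * B ^ 2) * V) ^ (1 / (d : ℝ)) := by
    have := hV.nonneg
    refine le_rpow_of_tendsto_of_forall_le (C := 2 * 2 ^ ε⁻¹)
      (tendsto_sizePAR_rpow_sigmaPAR hM hij) (fun _ => Nat.cast_nonneg _) hd (by positivity)
      (by positivity) fun n => ?_
    obtain ⟨P, hP, hPV⟩ := hV.exists_rectPotential_le hε hB hI hJ n
    calc (sizePAR (kroneckerPower M (d * n)) : ℝ) ≤ rectSize P := mod_cast hP.sizePAR_le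
      _ ≤ 2 * rectPotential ε P := rectSize_le_two_mul_rectPotential hε P
      _ ≤ 2 * 2 ^ ε⁻¹ * (Real.exp (ε * B ^ 2) * V) ^ n := by rw [mul_assoc]; gcongr
  have hcont : Continuous fun ε : ℝ => (Real.exp (ε * B ^ 2) * V) ^ (1 / (d : ℝ)) :=
    Continuous.rpow_const (by fun_prop) fun ε => Or.inr (by positivity)
  have hlim := (hcont.tendsto 0).mono_left (nhdsWithin_le_nhds (s := Set.Ioi 0))
  simp only [zero_mul, Real.exp_zero, one_mul] at hlim
  have hsmall : ∀ᶠ ε : ℝ in 𝓝[>] 0, ε * B < 1 :=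
    nhdsWithin_le_nhds ((continuous_mul_const B).tendsto' 0 0 (zero_mul B) |>.eventually_lt_const
      zero_lt_one)
  refine ge_of_tendsto hlim ?_
  filter_upwards [self_mem_nhdsWithin, hsmall] with ε hε hεB
  exact hbound hε hεB.le

end Potential

/-! ### Outputs of the merging procedure are partitionings -/

section MergingProcedure

open Finset

theorem coverCount_swapRects {I J : Type*} [DecidableEq I] [DecidableEq J]
    (P : Multiset (Rectangle I J)) (i : I) (j : J) :
    coverCount (swapRects P) j i = coverCount P i j := by
  rw [swapRects, coverCount_map]
  simp only [Prod.fst_swap, Prod.snd_swap, and_comm, coverCount]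

theorem coverCount_map_singleton {I J : Type*} [DecidableEq I] [DecidableEq J] (s : Finset I)
    (f : I → Finset J) (i : I) (j : J) :
    coverCount (s.val.map fun x => ({x}, f x)) i j = if i ∈ s ∧ j ∈ f i then 1 else 0 := by
  rw [coverCount_map]
  simp only [mem_singleton, ite_and]
  exact sum_ite_eq ..

variable {d r c a : ℕ} {𝒮 : Finset (Finset (Fin d))} {S S' S₁ S₂ T : Finset (Fin d)}
  {w : List Letter} {P : Multiset (Rectangle (Finset (Fin d)) (Finset (Fin d)))}

theorem coverCount_rowRects (d r c : ℕ) (S T : Finset (Fin d)) :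
    coverCount (rowRects d r c) S T = if Disjoint S T ∧ #S = r ∧ c ≤ #T then 1 else 0 := by
  rw [rowRects, coverCount_map_singleton]
  simp only [mem_filter, mem_univ, true_and, disjoint_comm (a := T), and_left_comm]

theorem IsPacking.eq_of_subset (h : IsPacking r a 𝒮) (hS : r ≤ #S) (h₁ : S₁ ∈ 𝒮) (h₂ : S₂ ∈ 𝒮)
    (hS₁ : S ⊆ S₁) (hS₂ : S ⊆ S₂) : S₁ = S₂ := by
  by_contra hne
  exact (h.2.2 S₁ h₁ S₂ h₂ hne).not_ge (hS.trans (card_le_card (subset_inter hS₁ hS₂)))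

theorem IsPacking.sum_ite_subset (h : IsPacking r a 𝒮) (S : Finset (Fin d)) :
    (∑ S' ∈ 𝒮, if S ⊆ S' ∧ r ≤ #S then 1 else 0) =
      if (∃ S' ∈ 𝒮, S ⊆ S') ∧ r ≤ #S then 1 else 0 := by
  split_ifs with hS
  · obtain ⟨⟨S', hS', hSS'⟩, hr⟩ := hS
    rw [sum_eq_single_of_mem S' hS' fun S₁ h₁ hne =>
      if_neg fun hS₁ => hne (h.eq_of_subset hr h₁ hS' hS₁.1 hSS'), if_pos ⟨hSS', hr⟩]
  · exact sum_eq_zero fun S' hS' => if_neg fun h => hS ⟨⟨S', hS', h.1⟩, h.2⟩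

/-- The rectangle of a chosen set `S'` and the single rows added for its subsets of size `r` cover
the entries that these rows would have contributed without merging. -/
theorem cover_cluster (hS' : #S' = r + 1) :
    ((if (S ⊆ S' ∧ r ≤ #S) ∧ Disjoint T S' ∧ c ≤ #T then 1 else 0) +
      if (S ⊆ S' ∧ #S = r) ∧ Disjoint T S ∧ ¬ Disjoint T S' ∧ c ≤ #T then 1 else 0) =
    if (S ⊆ S' ∧ r ≤ #S) ∧ Disjoint T S ∧ c ≤ #T then 1 else 0 := by
  by_cases hS : S ⊆ S' ∧ r ≤ #S
  · obtain ⟨hSS', hr⟩ := hS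
    rcases hr.eq_or_lt with hr | hr
    · have hmono : Disjoint T S' → Disjoint T S := Disjoint.mono_right hSS'
      by_cases hd : Disjoint T S' <;> simp_all
    · obtain rfl : S = S' := eq_of_subset_of_card_le hSS' (by omega)
      simp [hr.le, hr.ne']
  · have : ¬ (S ⊆ S' ∧ #S = r) := fun h => hS ⟨h.1, h.2.ge⟩
    simp [hS, this]

theorem coverCount_rowMergeRects (h : IsPacking r a 𝒮) (c : ℕ) (S T : Finset (Fin d)) :
    coverCount (rowMergeRects d r c 𝒮) S T =
      if Disjoint S T ∧ (#S = r ∨ #S = r + 1) ∧ c ≤ #T then 1 else 0 := by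
  have hcover : coverCount (rowMergeRects d r c 𝒮) S T =
      (∑ S' ∈ 𝒮, if (S ⊆ S' ∧ r ≤ #S) ∧ Disjoint T S ∧ c ≤ #T then 1 else 0) +
      if ((#S = r + 1 ∧ S ∉ 𝒮) ∨ (#S = r ∧ ∀ S' ∈ 𝒮, ¬ S ⊆ S')) ∧ Disjoint T S ∧ c ≤ #T
        then 1 else 0 := by
    rw [← sum_congr rfl fun S' hS' => cover_cluster (h.2.1 S' hS'), sum_add_distrib, rowMergeRects,
      coverCount_add, coverCount_add, coverCount_map_singleton, coverCount_map, coverCount_bind,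
      add_right_comm]
    simp only [coverCount_map_singleton, mem_filter, mem_univ, true_and]
    rfl
  rw [hcover]
  simp only [disjoint_comm (a := S)]
  by_cases hT : Disjoint T S ∧ c ≤ #T
  · simp only [hT, and_true, true_and, h.sum_ite_subset]
    by_cases hex : ∃ S' ∈ 𝒮, S ⊆ S'
    · obtain ⟨S', hS', hSS'⟩ := hex
      have hle := (card_le_card hSS').trans_eq (h.2.1 S' hS')
      have hunmerged : ¬ ((#S = r + 1 ∧ S ∉ 𝒮) ∨ (#S = r ∧ ∀ S' ∈ 𝒮, ¬ S ⊆ S')) := by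
        rintro (⟨hS, hS𝒮⟩ | ⟨-, hS⟩)
        · exact hS𝒮 (eq_of_subset_of_card_le hSS' (h.2.1 S' hS' ▸ hS.ge) ▸ hS')
        · exact hS S' hS' hSS'
      rw [if_neg hunmerged, add_zero]
      exact if_congr ⟨fun hS => by omega, fun hS => ⟨⟨S', hS', hSS'⟩, by omega⟩⟩ rfl rfl
    · have hnot : ∀ S' ∈ 𝒮, ¬ S ⊆ S' := fun S' hS' hSS' => hex ⟨S', hS', hSS'⟩
      have hS𝒮 : S ∉ 𝒮 := fun hS => hnot S hS subset_rfl
      rw [if_neg fun hS => hex hS.1, zero_add]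
      exact if_congr (by tauto) rfl rfl
  · simp [hT, show ¬ (Disjoint T S ∧ (#S = r ∨ #S = r + 1) ∧ c ≤ #T) by tauto]

/-- The amount by which a word increases the row counter. -/
def rowsRead : List Letter → ℕ
  | [] => 0
  | .row :: w => rowsRead w + 1
  | .rowMerge _ :: w => rowsRead w + 2
  | .col :: w | .colMerge _ :: w => rowsRead w

/-- The amount by which a word increases the column counter. -/
def colsRead : List Letter → ℕ
  | [] => 0
  | .col :: w => colsRead w + 1
  | .colMerge _ :: w => colsRead w + 2
  | .row :: w | .rowMerge _ :: w => colsRead w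

theorem MergeRun.coverCount_eq (h : MergeRun d w r c P) (S T : Finset (Fin d)) :
    coverCount P S T = if Disjoint S T ∧ (r ≤ #S ∧ c ≤ #T) ∧
      ¬ (r + rowsRead w ≤ #S ∧ c + colsRead w ≤ #T) then 1 else 0 := by
  induction h with
  | nil r c => simp [coverCount, rowsRead, colsRead]
  | row _ ih =>
    rw [coverCount_add, coverCount_rowRects, ih, rowsRead, colsRead]
    by_cases hd : Disjoint S T
    · simp only [hd, true_and]
      split_ifs <;> omega
    · simp [hd]
  | col _ ih =>
    rw [coverCount_add, coverCount_swapRects, coverCount_rowRects, ih, rowsRead, colsRead]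
    by_cases hd : Disjoint S T
    · simp only [hd, hd.symm, true_and]
      split_ifs <;> omega
    · simp [hd, disjoint_comm.not.1 hd]
  | rowMerge 𝒮 h𝒮 _ ih =>
    rw [coverCount_add, coverCount_rowMergeRects h𝒮, ih, rowsRead, colsRead]
    by_cases hd : Disjoint S T
    · simp only [hd, true_and]
      split_ifs <;> omega
    · simp [hd]
  | colMerge 𝒮 h𝒮 _ ih =>
    rw [coverCount_add, coverCount_swapRects, coverCount_rowMergeRects h𝒮, ih, rowsRead, colsRead]
    by_cases hd : Disjoint S T
    · simp only [hd, hd.symm, true_and]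
      split_ifs <;> omega
    · simp [hd, disjoint_comm.not.1 hd]

theorem kroneckerPower_disjointnessMatrix_indicatorTuple (S T : Finset (Fin d)) :
    kroneckerPower (disjointnessMatrix ℕ) d (indicatorTuple S) (indicatorTuple T) =
      if Disjoint S T then 1 else 0 := by
  have hentry (t : Fin d) : disjointnessMatrix ℕ (indicatorTuple S t) (indicatorTuple T t) =
      if t ∈ S → t ∉ T then 1 else 0 := by
    by_cases hS : t ∈ S <;> by_cases hT : t ∈ T <;>
      simp [disjointnessMatrix, indicatorTuple, hS, hT]
  simp only [kroneckerPower, Matrix.of_apply, hentry, disjoint_left, prod_boole, mem_univ,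
    forall_const]

/-- When the final counters add up to more than `d`, no disjoint pair is left over. -/
theorem MergeRun.isPartitioning (h : MergeRun d w 0 0 P) (hw : d < rowsRead w + colsRead w) :
    IsPartitioning P
      ((kroneckerPower (disjointnessMatrix ℕ) d).submatrix indicatorTuple indicatorTuple) := by
  intro S T
  rw [Matrix.submatrix_apply, kroneckerPower_disjointnessMatrix_indicatorTuple]
  refine (h.coverCount_eq S T).trans (if_congr (and_iff_left_of_imp fun hd => ?_) rfl rfl)
  have hcard : #S + #T ≤ d := by
    simpa only [← card_union_of_disjoint hd, Fintype.card_fin] using card_le_univ (S ∪ T)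
  omega

/-! ### The sizes of the rectangles of an output -/

/-- The number of subsets of size at least `c` of a set of size `n`. -/
def upperCount (n c : ℕ) : ℕ := ∑ j ∈ range (n + 1), if c ≤ j then n.choose j else 0

theorem card_filter_disjoint (S : Finset (Fin d)) (c : ℕ) :
    #{T | Disjoint T S ∧ c ≤ #T} = upperCount (d - #S) c := by
  have hpowerset : ({T | Disjoint T S ∧ c ≤ #T} : Finset (Finset (Fin d))) =
      Sᶜ.powerset.filter (c ≤ #·) := by
    ext T
    simp [subset_compl_iff_disjoint_right]
  have hsum := sum_powerset_apply_card (fun j => if c ≤ j then 1 else 0) (x := Sᶜ)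
  simp only [smul_eq_mul, mul_ite, mul_one, mul_zero, card_compl, Fintype.card_fin] at hsum
  rw [hpowerset, card_filter, hsum, upperCount]

theorem card_filter_subset_le (hS' : #S' = r + 1) : #{S | S ⊆ S' ∧ r ≤ #S} = r + 2 := by
  have hle := card_le_univ S'
  rw [Fintype.card_fin] at hle
  have hcard := card_filter_disjoint S'ᶜ r
  simp only [disjoint_compl_right_iff, card_compl, Fintype.card_fin, Nat.sub_sub_self hle] at hcard
  change #{S | S ≤ S' ∧ r ≤ #S} = r + 2
  have hlt : ∑ j ∈ range r, (if r ≤ j then (r + 1).choose j else 0) = 0 :=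
    sum_eq_zero fun j hj => if_neg (mem_range.1 hj).not_ge
  rw [hcard, hS', upperCount, sum_range_succ, sum_range_succ, hlt, if_pos le_rfl,
    if_pos (Nat.le_succ r), Nat.choose_self, Nat.choose_succ_self_right, zero_add]

theorem filter_card_eq (d r : ℕ) :
    ({S | #S = r} : Finset (Finset (Fin d))) = powersetCard r univ := by
  ext S
  simp

theorem filter_subset_card_eq (S' : Finset (Fin d)) (r : ℕ) :
    ({S | S ⊆ S' ∧ #S = r} : Finset (Finset (Fin d))) = powersetCard r S' := by
  ext S
  simp

theorem IsPacking.card_unmerged_succ (h : IsPacking r a 𝒮) :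
    #{S | #S = r + 1 ∧ S ∉ 𝒮} = d.choose (r + 1) - a := by
  have hsdiff : ({S | #S = r + 1 ∧ S ∉ 𝒮} : Finset (Finset (Fin d))) =
      powersetCard (r + 1) univ \ 𝒮 := by
    ext S
    simp
  rw [hsdiff, card_sdiff_of_subset, card_powersetCard, card_fin, h.1]
  exact fun S hS => mem_powersetCard.2 ⟨subset_univ S, h.2.1 S hS⟩

theorem IsPacking.card_unmerged (h : IsPacking r a 𝒮) :
    #{S | #S = r ∧ ∀ S' ∈ 𝒮, ¬ S ⊆ S'} = d.choose r - a * (r + 1) := by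
  have hmerged : ({S | #S = r ∧ ∀ S' ∈ 𝒮, ¬ S ⊆ S'} : Finset (Finset (Fin d))) =
      powersetCard r univ \ 𝒮.biUnion (powersetCard r) := by
    ext S
    simp only [mem_filter, mem_univ, true_and, Finset.mem_sdiff, mem_powersetCard, subset_univ,
      mem_biUnion, not_exists, not_and]
    exact ⟨fun hS => ⟨hS.1, fun S' hS' hSS' => absurd hSS' (hS.2 S' hS')⟩,
      fun hS => ⟨hS.1, fun S' hS' hSS' => hS.2 S' hS' hSS' hS.1⟩⟩
  have hdisj : (𝒮 : Set (Finset (Fin d))).PairwiseDisjoint (powersetCard r) := by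
    refine fun S₁ h₁ S₂ h₂ hne => disjoint_left.2 fun S hS₁ hS₂ => hne ?_
    rw [mem_powersetCard] at hS₁ hS₂
    exact h.eq_of_subset hS₁.2.ge h₁ h₂ hS₁.1 hS₂.1
  have hcard : ∀ S' ∈ 𝒮, #(powersetCard r S') = r + 1 := fun S' hS' => by
    rw [card_powersetCard, h.2.1 S' hS', Nat.choose_succ_self_right]
  rw [hmerged, card_sdiff_of_subset, card_powersetCard, card_fin, card_biUnion hdisj,
    sum_congr rfl hcard, sum_const, h.1, smul_eq_mul]
  exact biUnion_subset.2 fun S' _ => powersetCard_mono (subset_univ S')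

theorem card_filter_disjoint_not_disjoint (hSS' : S ⊆ S') (c : ℕ) :
    #{T | Disjoint T S ∧ ¬ Disjoint T S' ∧ c ≤ #T} =
      upperCount (d - #S) c - upperCount (d - #S') c := by
  have hsdiff : ({T | Disjoint T S ∧ ¬ Disjoint T S' ∧ c ≤ #T} : Finset (Finset (Fin d))) =
      ({T | Disjoint T S ∧ c ≤ #T} : Finset _) \ ({T | Disjoint T S' ∧ c ≤ #T} : Finset _) := by
    ext T
    simp only [mem_filter, mem_univ, true_and, Finset.mem_sdiff]
    tauto
  rw [hsdiff, card_sdiff_of_subset, card_filter_disjoint, card_filter_disjoint]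
  exact monotone_filter_right _ fun _ _ hT => ⟨hT.1.mono_right hSS', hT.2⟩

/-- The rectangle sizes of the family `P` are those listed in `L`, whose entries `(n, i, j)` stand
for `n` rectangles with `i` rows and `j` columns. -/
def HasSizeTable {I J : Type*} (P : Multiset (Rectangle I J)) (L : List (ℕ × ℕ × ℕ)) : Prop :=
  P.map (fun Q => (#Q.1, #Q.2)) = (L.map fun x => Multiset.replicate x.1 x.2).sum

namespace HasSizeTable

variable {I J : Type*} {P P' : Multiset (Rectangle I J)} {L L' : List (ℕ × ℕ × ℕ)}

theorem add (hP : HasSizeTable P L) (hP' : HasSizeTable P' L') :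
    HasSizeTable (P + P') (L ++ L') := by
  rw [HasSizeTable, Multiset.map_add, hP, hP', List.map_append, List.sum_append]

theorem swapRects (hP : HasSizeTable P L) :
    HasSizeTable (swapRects P) (L.map fun x => (x.1, x.2.swap)) := by
  have hswap := congrArg (Multiset.map Prod.swap) hP
  rw [Multiset.map_map, ← Multiset.coe_mapAddMonoidHom Prod.swap, map_list_sum,
    List.map_map] at hswap
  rw [HasSizeTable, _root_.swapRects, Multiset.map_map, List.map_map]
  simpa only [Function.comp_def, Multiset.coe_mapAddMonoidHom, Multiset.map_replicate,
    Prod.swap_prod_mk, Prod.fst_swap, Prod.snd_swap] using hswap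

theorem map_of_card_eq {ι : Type*} {s : Finset ι} {f : ι → Rectangle I J} {n i j : ℕ}
    (hs : #s = n) (hi : ∀ x ∈ s, #(f x).1 = i) (hj : ∀ x ∈ s, #(f x).2 = j) :
    HasSizeTable (s.val.map f) [(n, i, j)] := by
  rw [HasSizeTable, Multiset.map_map, List.map_singleton, List.sum_singleton, ← hs, Finset.card,
    ← Multiset.map_const']
  exact Multiset.map_congr rfl fun x hx => Prod.ext (hi x hx) (hj x hx)

theorem bind_of_forall {ι : Type*} {s : Finset ι} {f : ι → Multiset (Rectangle I J)}
    {n i j : ℕ} (h : ∀ x ∈ s, HasSizeTable (f x) [(n, i, j)]) :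
    HasSizeTable (s.val.bind f) [(#s * n, i, j)] := by
  rw [HasSizeTable, Multiset.map_bind, Multiset.bind_congr h]
  simp only [List.map_singleton, List.sum_singleton, Multiset.bind, Multiset.map_const',
    Multiset.join, Multiset.sum_replicate, Multiset.nsmul_replicate, Finset.card]

end HasSizeTable

/-- The sizes of the rectangles added at the letter `R` with counters `r` and `c`. -/
def rowTable (d r c : ℕ) : List (ℕ × ℕ × ℕ) :=
  [(d.choose r, 1, upperCount (d - r) c)]

/-- The sizes of the rectangles added at the letter `R⁺` with counters `r` and `c`, for any choice
of `a` sets. -/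
def rowMergeTable (d r c a : ℕ) : List (ℕ × ℕ × ℕ) :=
  [(a, r + 2, upperCount (d - (r + 1)) c),
    (d.choose (r + 1) - a, 1, upperCount (d - (r + 1)) c),
    (d.choose r - a * (r + 1), 1, upperCount (d - r) c),
    (a * (r + 1), 1, upperCount (d - r) c - upperCount (d - (r + 1)) c)]

/-- The sizes of the rectangles in the output of the merging procedure. -/
def wordTable (d : ℕ) : List Letter → ℕ → ℕ → List (ℕ × ℕ × ℕ)
  | [], _, _ => []
  | .row :: w, r, c => rowTable d r c ++ wordTable d w (r + 1) c
  | .col :: w, r, c => (rowTable d c r).map (fun x => (x.1, x.2.swap)) ++ wordTable d w r (c + 1)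
  | .rowMerge a :: w, r, c => rowMergeTable d r c a ++ wordTable d w (r + 2) c
  | .colMerge a :: w, r, c =>
    (rowMergeTable d c r a).map (fun x => (x.1, x.2.swap)) ++ wordTable d w r (c + 2)

theorem hasSizeTable_rowRects (d r c : ℕ) : HasSizeTable (rowRects d r c) (rowTable d r c) :=
  .map_of_card_eq (by rw [filter_card_eq, card_powersetCard, card_fin])
    (fun S _ => card_singleton S) fun S hS => by rw [card_filter_disjoint, (mem_filter.1 hS).2]

theorem hasSizeTable_rowMergeRects (h : IsPacking r a 𝒮) (c : ℕ) :
    HasSizeTable (rowMergeRects d r c 𝒮) (rowMergeTable d r c a) := by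
  have hmerged : HasSizeTable (𝒮.val.map fun S' =>
      (({S | S ⊆ S' ∧ r ≤ #S} : Finset _), ({T | Disjoint T S' ∧ c ≤ #T} : Finset _)))
      [(a, r + 2, upperCount (d - (r + 1)) c)] :=
    .map_of_card_eq h.1 (fun S' hS' => card_filter_subset_le (h.2.1 S' hS'))
      fun S' hS' => by rw [card_filter_disjoint, h.2.1 S' hS']
  have hunmerged : HasSizeTable
      ((({S | #S = r + 1 ∧ S ∉ 𝒮} : Finset _).val +
        ({S | #S = r ∧ ∀ S' ∈ 𝒮, ¬ S ⊆ S'} : Finset _).val).map fun S =>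
          ({S}, ({T | Disjoint T S ∧ c ≤ #T} : Finset _)))
      [(d.choose (r + 1) - a, 1, upperCount (d - (r + 1)) c),
        (d.choose r - a * (r + 1), 1, upperCount (d - r) c)] := by
    rw [Multiset.map_add]
    refine .add (.map_of_card_eq h.card_unmerged_succ (fun S _ => card_singleton S) fun S hS => ?_)
      (.map_of_card_eq h.card_unmerged (fun S _ => card_singleton S) fun S hS => ?_) <;>
    rw [card_filter_disjoint, (mem_filter.1 hS).2.1]
  have hrest : HasSizeTable (𝒮.val.bind fun S' => ({S | S ⊆ S' ∧ #S = r} : Finset _).val.map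
      fun S => ({S}, ({T | Disjoint T S ∧ ¬ Disjoint T S' ∧ c ≤ #T} : Finset _)))
      [(a * (r + 1), 1, upperCount (d - r) c - upperCount (d - (r + 1)) c)] := by
    rw [← h.1]
    refine .bind_of_forall fun S' hS' => .map_of_card_eq ?_ (fun S _ => card_singleton S)
      fun S hS => ?_
    · rw [filter_subset_card_eq, card_powersetCard, h.2.1 S' hS', Nat.choose_succ_self_right]
    · have hSS' := (mem_filter.1 hS).2
      rw [card_filter_disjoint_not_disjoint hSS'.1, hSS'.2, h.2.1 S' hS']
  have hdisj : Disjoint ({S | #S = r + 1 ∧ S ∉ 𝒮} : Finset (Finset (Fin d)))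
      ({S | #S = r ∧ ∀ S' ∈ 𝒮, ¬ S ⊆ S'} : Finset _) :=
    disjoint_filter.2 fun S _ hS hS' => by omega
  rw [rowMergeRects, filter_or, ← disjUnion_eq_union _ _ hdisj]
  exact (hmerged.add hunmerged).add hrest

theorem MergeRun.hasSizeTable (h : MergeRun d w r c P) : HasSizeTable P (wordTable d w r c) := by
  induction h with
  | nil => rfl
  | row _ ih => exact (hasSizeTable_rowRects ..).add ih
  | col _ ih => exact (hasSizeTable_rowRects ..).swapRects.add ih
  | rowMerge 𝒮 h𝒮 _ ih => exact (hasSizeTable_rowMergeRects h𝒮 _).add ih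
  | colMerge 𝒮 h𝒮 _ ih => exact (hasSizeTable_rowMergeRects h𝒮 _).swapRects.add ih

/-- The `α`-volume of a family of rectangles with the given table of sizes. -/
noncomputable def tableVolume (L : List (ℕ × ℕ × ℕ)) (α : ℝ) : ℝ :=
  (L.map fun x => (x.1 : ℝ) * ((x.2.1 : ℝ) ^ α * (x.2.2 : ℝ) ^ (1 - α))).sum

theorem HasSizeTable.alphaVolume_eq {I J : Type*} {P : Multiset (Rectangle I J)}
    {L : List (ℕ × ℕ × ℕ)} (hP : HasSizeTable P L) (α : ℝ) :
    alphaVolume P α = tableVolume L α := by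
  let volume : ℕ × ℕ → ℝ := fun x => (x.1 : ℝ) ^ α * (x.2 : ℝ) ^ (1 - α)
  calc alphaVolume P α = ((P.map fun Q => (#Q.1, #Q.2)).map volume).sum := by
        rw [Multiset.map_map]
        rfl
    _ = tableVolume L α := by
        rw [hP, ← Multiset.coe_mapAddMonoidHom, ← Multiset.coe_sumAddMonoidHom, map_list_sum,
          map_list_sum, List.map_map, List.map_map, tableVolume]
        simp [Function.comp_def, volume]

end MergingProcedure

/-! ### Volume estimates -/

section Volumes

/-- A lower approximation of `s` times the volume of a table for the exponent `a / (a + b)`,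
computed with integer roots; each rectangle loses less than `1`. -/
def rootVolume (L : List (ℕ × ℕ × ℕ)) (s a b : ℕ) : ℕ :=
  (L.map fun x => x.1 * Nat.nthRoot (a + b) (x.2.1 ^ a * x.2.2 ^ b * s ^ (a + b))).sum

/-- The number of rectangles in a table. -/
def tableCount (L : List (ℕ × ℕ × ℕ)) : ℕ := (L.map Prod.fst).sum

theorem nthRoot_le_mul_rpow_lt {s a b : ℕ} (hab : a + b ≠ 0) (i j : ℕ) :
    let r := Nat.nthRoot (a + b) (i ^ a * j ^ b * s ^ (a + b))
    let v : ℝ := s * ((i : ℝ) ^ (a / (a + b) : ℝ) * (j : ℝ) ^ (1 - a / (a + b) : ℝ))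
    r ≤ v ∧ v < r + 1 := by
  intro r v
  have hsum : (a + b : ℝ) ≠ 0 := mod_cast hab
  have hv : v ^ (a + b) = (i ^ a * j ^ b * s ^ (a + b) : ℕ) := by
    have hrpow (x : ℕ) (e : ℝ) (c : ℕ) (hc : e * (a + b : ℕ) = c) :
        ((x : ℝ) ^ e) ^ (a + b) = x ^ c := by
      rw [← Real.rpow_mul_natCast x.cast_nonneg, hc, Real.rpow_natCast]
    rw [mul_pow, mul_pow, hrpow i _ a (by push_cast; field_simp),
      hrpow j _ b (by push_cast; field_simp; ring)]
    push_cast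
    ring
  constructor
  · refine le_of_pow_le_pow_left₀ hab (by positivity) ?_
    rw [hv]
    exact_mod_cast Nat.pow_nthRoot_le (Or.inl hab)
  · refine lt_of_pow_lt_pow_left₀ (a + b) (by positivity) ?_
    rw [hv]
    exact_mod_cast Nat.lt_pow_nthRoot_add_one hab _

theorem lt_tableVolume_of_mul_lt_rootVolume {L : List (ℕ × ℕ × ℕ)} {s a b V : ℕ}
    (hab : a + b ≠ 0) (h : s * V < rootVolume L s a b) : V < tableVolume L (a / (a + b)) := by
  have hle : (rootVolume L s a b : ℝ) ≤ s * tableVolume L (a / (a + b)) := by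
    rw [rootVolume, Nat.cast_list_sum, List.map_map, tableVolume, ← List.sum_map_mul_left]
    refine List.sum_le_sum fun x _ => ?_
    rw [Function.comp_apply, Nat.cast_mul, mul_left_comm]
    exact mul_le_mul_of_nonneg_left (nthRoot_le_mul_rpow_lt hab _ _).1 x.1.cast_nonneg
  have hlt : (s : ℝ) * V < rootVolume L s a b := mod_cast h
  exact lt_of_mul_lt_mul_left (hlt.trans_le hle) s.cast_nonneg

theorem tableVolume_lt_of_rootVolume_add_lt {L : List (ℕ × ℕ × ℕ)} {s a b V : ℕ}
    (hab : a + b ≠ 0) (h : rootVolume L s a b + tableCount L < s * V) :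
    tableVolume L (a / (a + b)) < V := by
  have hle : s * tableVolume L (a / (a + b)) ≤ rootVolume L s a b + tableCount L := by
    rw [rootVolume, tableCount, Nat.cast_list_sum, Nat.cast_list_sum, List.map_map, List.map_map,
      ← List.sum_map_add, tableVolume, ← List.sum_map_mul_left]
    refine List.sum_le_sum fun x _ => ?_
    rw [Function.comp_apply, Function.comp_apply, Nat.cast_mul, mul_left_comm, ← mul_add_one]
    exact mul_le_mul_of_nonneg_left (nthRoot_le_mul_rpow_lt hab _ _).2.le x.1.cast_nonneg
  have hlt : (rootVolume L s a b + tableCount L : ℝ) < s * V := mod_cast h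
  exact lt_of_mul_lt_mul_left (hle.trans_lt hlt) s.cast_nonneg

/-- The table of rectangle sizes of every output of the merging procedure on `mergeWord`. -/
def mergeTable : List (ℕ × ℕ × ℕ) := wordTable 18 mergeWord 0 0

theorem tableVolume_mergeTable_half_lt : tableVolume mergeTable (1 / 2) < 5889105 := by
  have hcalc : rootVolume mergeTable (10 ^ 6) 1 1 + tableCount mergeTable < 10 ^ 6 * 5889105 := by
    decide +kernel
  have hlt := tableVolume_lt_of_rootVolume_add_lt two_ne_zero hcalc
  norm_num at hlt ⊢
  exact hlt

theorem lt_tableVolume_mergeTable_half : 5889000 < tableVolume mergeTable (1 / 2) := by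
  have hcalc : 10 ^ 6 * 5889000 < rootVolume mergeTable (10 ^ 6) 1 1 := by decide +kernel
  have hlt := lt_tableVolume_of_mul_lt_rootVolume two_ne_zero hcalc
  norm_num at hlt ⊢
  exact hlt

theorem tableVolume_mergeTable_skew_lt : tableVolume mergeTable (6 / 11) < 5889000 := by
  have hcalc : rootVolume mergeTable (10 ^ 3) 6 5 + tableCount mergeTable < 10 ^ 3 * 5889000 := by
    decide +kernel
  have hlt := tableVolume_lt_of_rootVolume_add_lt (by norm_num) hcalc
  norm_num at hlt ⊢
  exact hlt

theorem convexOn_rpow_mul_rpow_one_sub (x y : ℕ) :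
    ConvexOn ℝ (Set.Ioo 0 1) fun α : ℝ => (x : ℝ) ^ α * (y : ℝ) ^ (1 - α) := by
  rcases x.eq_zero_or_pos with rfl | hx
  · refine (convexOn_const (0 : ℝ) (convex_Ioo 0 1)).congr fun α hα => ?_
    simp [Real.zero_rpow hα.1.ne']
  rcases y.eq_zero_or_pos with rfl | hy
  · refine (convexOn_const (0 : ℝ) (convex_Ioo 0 1)).congr fun α hα => ?_
    simp [Real.zero_rpow (sub_pos.2 hα.2).ne']
  have hconv : ConvexOn ℝ Set.univ fun α : ℝ => (y : ℝ) * (x / y : ℝ) ^ α :=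
    (convexOn_rpow_left (by positivity)).smul y.cast_nonneg
  refine (hconv.subset (Set.subset_univ _) (convex_Ioo 0 1)).congr fun α _ => ?_
  have hy₀ : (0 : ℝ) < y := mod_cast hy
  simp only
  rw [Real.div_rpow x.cast_nonneg hy₀.le, Real.rpow_sub hy₀, Real.rpow_one]
  ring

theorem convexOn_tableVolume (L : List (ℕ × ℕ × ℕ)) : ConvexOn ℝ (Set.Ioo 0 1) (tableVolume L) := by
  induction L with
  | nil => exact convexOn_const 0 (convex_Ioo 0 1)
  | cons x L ih =>
    refine (((convexOn_rpow_mul_rpow_one_sub x.2.1 x.2.2).smul x.1.cast_nonneg).add ih).congr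
      fun α _ => ?_
    simp [tableVolume]

end Volumes

theorem rpow_tableVolume_mergeTable_lt :
    tableVolume mergeTable (1 / 2) ^ (1 / 18 : ℝ) < (2 : ℝ) ^ (1.249424 : ℝ) := by
  have hpos : 0 < tableVolume mergeTable (1 / 2) :=
    (by norm_num : (0 : ℝ) < 5889000).trans lt_tableVolume_mergeTable_half
  -- `5420 / 241` lies between `log₂ 5889105` and `18 * 1.249424`.
  have hlog : (5889105 : ℝ) < 2 ^ (5420 / 241 : ℝ) := by
    refine lt_of_pow_lt_pow_left₀ 241 (by positivity) ?_
    rw [← Real.rpow_mul_natCast zero_le_two,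
      show (5420 / 241 : ℝ) * (241 : ℕ) = (5420 : ℕ) by norm_num, Real.rpow_natCast]
    exact_mod_cast (by decide +kernel : 5889105 ^ 241 < 2 ^ 5420)
  calc tableVolume mergeTable (1 / 2) ^ (1 / 18 : ℝ)
      < (2 ^ (5420 / 241 : ℝ)) ^ (1 / 18 : ℝ) :=
        Real.rpow_lt_rpow hpos.le (tableVolume_mergeTable_half_lt.trans hlog) (by norm_num)
    _ = (2 : ℝ) ^ (5420 / 241 * (1 / 18) : ℝ) := (Real.rpow_mul zero_le_two _ _).symm
    _ ≤ (2 : ℝ) ^ (1.249424 : ℝ) :=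
        Real.rpow_le_rpow_of_exponent_le one_le_two (by norm_num)

theorem alphaVolume_swapRects {I J : Type*} (P : Multiset (Rectangle I J)) (α : ℝ) :
    alphaVolume (swapRects P) α = alphaVolume P (1 - α) := by
  simp [alphaVolume, swapRects, mul_comm]

theorem IsPartitioning.swapRects {I J : Type*} [DecidableEq I] [DecidableEq J]
    {P : Multiset (Rectangle I J)} {M : Matrix I J ℕ} (hP : IsPartitioning P M) :
    IsPartitioning (swapRects P) M.transpose := fun j i =>
  (coverCount_swapRects P i j).trans (hP i j)

theorem HasVolumeBound.of_transpose_eq {I : Type*} [DecidableEq I] {M : Matrix I I ℕ} {V : ℝ}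
    (hM : M.transpose = M)
    (h : ∀ p ∈ Set.Icc (1 / 2 : ℝ) 1, ∃ P, IsPartitioning P M ∧ alphaVolume P p ≤ V) :
    HasVolumeBound M V := by
  rintro p ⟨hp₀, hp₁⟩
  rcases le_total (1 / 2) p with hp | hp
  · exact h p ⟨hp, hp₁⟩
  · obtain ⟨P, hP, hPV⟩ := h (1 - p) ⟨by linarith, by linarith⟩
    exact ⟨swapRects P, hM ▸ hP.swapRects, by rwa [alphaVolume_swapRects]⟩

theorem kroneckerPower_transpose {I J α : Type*} [CommSemiring α] (M : Matrix I J α) (k : ℕ) :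
    (kroneckerPower M k).transpose = kroneckerPower M.transpose k := rfl

theorem disjointnessMatrix_transpose (α : Type*) [Zero α] [One α] :
    (disjointnessMatrix α).transpose = disjointnessMatrix α :=
  Matrix.eta_fin_two _

theorem disjointnessMatrix_apply_le_one (i j : Fin 2) : disjointnessMatrix ℕ i j ≤ 1 := by
  fin_cases i <;> fin_cases j <;> simp [disjointnessMatrix]

theorem alphaVolume_rowPartitioning {I J : Type*} [Fintype I] [Fintype J] (M : Matrix I J ℕ)
    (α : ℝ) : alphaVolume (rowPartitioning M) α =
      ∑ i, ((Finset.univ.filter (M i · = 1)).card : ℝ) ^ (1 - α) := by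
  simp [alphaVolume, rowPartitioning]

theorem alphaVolume_rowPartitioning_kroneckerPower {I J : Type*} [Fintype I] [Fintype J]
    (M : Matrix I J ℕ) (k : ℕ) (α : ℝ) :
    alphaVolume (rowPartitioning (kroneckerPower M k)) α =
      alphaVolume (rowPartitioning M) α ^ k := by
  classical
  have hrow (i : Fin k → I) : Finset.univ.filter (kroneckerPower M k i · = 1) =
      Fintype.piFinset fun t => Finset.univ.filter (M (i t) · = 1) := by
    ext j
    simp [kroneckerPower, Finset.prod_eq_one_iff]
  simp only [alphaVolume_rowPartitioning, hrow, Fintype.card_piFinset, Nat.cast_prod]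
  rw [Fintype.sum_pow]
  exact Finset.sum_congr rfl fun i _ =>
    (Real.finsetProd_rpow _ _ (fun t _ => Nat.cast_nonneg _) _).symm

theorem alphaVolume_rowPartitioning_disjointnessMatrix_pow_lt {p : ℝ} (hp : 6 / 11 ≤ p) :
    alphaVolume (rowPartitioning (kroneckerPower (disjointnessMatrix ℕ) 18)) p < 5889000 := by
  have hvolume : alphaVolume (rowPartitioning (disjointnessMatrix ℕ)) p = 2 ^ (1 - p) + 1 := by
    have hrows : (Finset.univ.filter (disjointnessMatrix ℕ 0 · = 1)).card = 2 ∧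
        (Finset.univ.filter (disjointnessMatrix ℕ 1 · = 1)).card = 1 := by decide
    rw [alphaVolume_rowPartitioning, Fin.sum_univ_two, hrows.1, hrows.2, Nat.cast_one,
      Real.one_rpow, Nat.cast_ofNat]
  have hroot : (2 : ℝ) ^ (5 / 11 : ℝ) < 11 / 8 := by
    refine lt_of_pow_lt_pow_left₀ 11 (by norm_num) ?_
    rw [← Real.rpow_mul_natCast zero_le_two,
      show (5 / 11 : ℝ) * (11 : ℕ) = (5 : ℕ) by norm_num, Real.rpow_natCast]
    norm_num
  calc alphaVolume (rowPartitioning (kroneckerPower (disjointnessMatrix ℕ) 18)) p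
      = (2 ^ (1 - p) + 1) ^ 18 := by
        rw [alphaVolume_rowPartitioning_kroneckerPower, hvolume]
    _ ≤ (2 ^ (5 / 11 : ℝ) + 1) ^ 18 := by
        gcongr
        · exact one_le_two
        · linarith
    _ ≤ (11 / 8 + 1) ^ 18 := by gcongr
    _ < 5889000 := by norm_num

/-- The correspondence between the subsets of `Fin d` and their `0/1`-vectors. -/
def indicatorEquiv (d : ℕ) : Finset (Fin d) ≃ (Fin d → Fin 2) where
  toFun := indicatorTuple
  invFun v := Finset.univ.filter (v · = 1)
  left_inv S := by
    ext t
    simp [indicatorTuple]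
  right_inv v := by
    ext t
    rcases Fin.exists_fin_two.1 ⟨v t, rfl⟩ with h | h <;> simp [indicatorTuple, h]

theorem alphaVolume_map_rectangleMap {I J I' J' : Type*} (e : I ≃ I') (f : J ≃ J')
    (P : Multiset (Rectangle I J)) (α : ℝ) :
    alphaVolume (P.map (Rectangle.map e f)) α = alphaVolume P α := by
  simp [alphaVolume, Rectangle.map]

theorem MergeRun.exists_isPartitioning {d : ℕ} {w : List Letter}
    {P : Multiset (Rectangle (Finset (Fin d)) (Finset (Fin d)))} (h : MergeRun d w 0 0 P)
    (hw : d < rowsRead w + colsRead w) :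
    ∃ P', IsPartitioning P' (kroneckerPower (disjointnessMatrix ℕ) d) ∧
      ∀ α, alphaVolume P' α = tableVolume (wordTable d w 0 0) α := by
  refine ⟨P.map (Rectangle.map (indicatorEquiv d) (indicatorEquiv d)), ?_, fun α => ?_⟩
  · have hmap := (h.isPartitioning hw).map (indicatorEquiv d) (indicatorEquiv d)
    convert hmap using 1
    ext v v'
    simp only [Matrix.submatrix_apply]
    exact congrArg₂ _ ((indicatorEquiv d).apply_symm_apply v).symm
      ((indicatorEquiv d).apply_symm_apply v').symm
  · rw [alphaVolume_map_rectangleMap, h.hasSizeTable.alphaVolume_eq]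

/-- The output serves for `p ∈ [1/2, 6/11]` by convexity, the rows for larger `p`, and the
transposed families for `p < 1/2`. -/
theorem MergeRun.hasVolumeBound {P : Multiset (Rectangle (Finset (Fin 18)) (Finset (Fin 18)))}
    (hP : MergeRun 18 mergeWord 0 0 P) :
    HasVolumeBound (kroneckerPower (disjointnessMatrix ℕ) 18) (alphaVolume P (1 / 2)) := by
  rw [hP.hasSizeTable.alphaVolume_eq, ← mergeTable]
  refine .of_transpose_eq (by rw [kroneckerPower_transpose, disjointnessMatrix_transpose]) ?_
  rintro p ⟨hp₀, -⟩
  rcases le_total p (6 / 11) with hp | hp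
  · obtain ⟨P', hP', hvolume⟩ := hP.exists_isPartitioning (by decide)
    refine ⟨P', hP', ?_⟩
    calc alphaVolume P' p = tableVolume mergeTable p := hvolume p
      _ ≤ max (tableVolume mergeTable (1 / 2)) (tableVolume mergeTable (6 / 11)) :=
        (convexOn_tableVolume mergeTable).le_max_of_mem_Icc (by norm_num) (by norm_num) ⟨hp₀, hp⟩
      _ = tableVolume mergeTable (1 / 2) :=
        max_eq_left (tableVolume_mergeTable_skew_lt.trans lt_tableVolume_mergeTable_half).le
  · refine ⟨_, isPartitioning_rowPartitioning
      (kroneckerPower_apply_le_one disjointnessMatrix_apply_le_one _),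
      ((alphaVolume_rowPartitioning_disjointnessMatrix_pow_lt hp).trans
        lt_tableVolume_mergeTable_half).le⟩

/-! ### Packings of pairs, quadruples and sextuples -/

section Packings

open Finset

/-- The subset of `Fin d` encoded by the binary digits of `m`, for checking packings by
computation. -/
def bitSet (d m : ℕ) : Finset (Fin d) := univ.filter fun t => m.testBit t

/-- The number of digits `1` among the lowest `d` binary digits of `m`. -/
def bitCount : ℕ → ℕ → ℕ
  | 0, _ => 0
  | d + 1, m => m % 2 + bitCount d (m / 2)

theorem card_bitSet (d m : ℕ) : #(bitSet d m) = bitCount d m := by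
  induction d generalizing m with
  | zero => rfl
  | succ d ih =>
    rw [bitCount, ← ih]
    simp only [bitSet, card_filter, Fin.sum_univ_succ, Fin.val_zero, Fin.val_succ,
      Nat.testBit_succ, Nat.testBit_zero]
    rcases Nat.mod_two_eq_zero_or_one m with h | h <;> simp [h]

theorem bitSet_inter_bitSet (d m n : ℕ) : bitSet d m ∩ bitSet d n = bitSet d (m &&& n) := by
  ext t
  simp [bitSet]

theorem isPacking_map_bitSet {d r a : ℕ} {l : List ℕ} (hlength : l.length = a)
    (hsize : ∀ m ∈ l, bitCount d m = r + 1)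
    (hinter : l.Pairwise fun m n => bitCount d (m &&& n) < r) :
    IsPacking r a (l.map (bitSet d)).toFinset := by
  simp only [← card_bitSet, ← bitSet_inter_bitSet] at hsize hinter
  have hsymm : Std.Symm fun m n => #(bitSet d m ∩ bitSet d n) < r :=
    ⟨fun m n h => by rwa [inter_comm]⟩
  have hnodup : (l.map (bitSet d)).Nodup := by
    refine List.pairwise_map.2 (hinter.imp_of_mem fun hm _ h heq => ?_)
    rw [← heq, inter_self, hsize _ hm] at h
    omega
  simp only [IsPacking, List.toFinset_card_of_nodup hnodup, List.mem_toFinset, List.length_map,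
    List.mem_map, forall_exists_index, and_imp, forall_apply_eq_imp_iff₂]
  exact ⟨hlength, hsize, fun m hm n hn hne => hinter.forall hm hn (hne <| congrArg _ ·)⟩

/-- The pairs `{2 * i, 2 * i + 1}`, as binary numbers. -/
def pairMasks : List ℕ := (List.range 9).map fun i => 3 * 4 ^ i

theorem isPacking_pairMasks : IsPacking 1 9 (pairMasks.map (bitSet 18)).toFinset :=
  isPacking_map_bitSet (by decide +kernel) (by decide +kernel) (by decide +kernel)

/-- The binary number with its only digit `1` at point `x` of hexagon `i`, when `18` points are
split into three hexagons; `i` and `x` are taken modulo `3` and `6`. -/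
def hexagonPoint (i x : ℕ) : ℕ := 2 ^ (6 * (i % 3) + x % 6)

/-- The pairs of non-neighbouring points of a hexagon. -/
def hexagonDiagonals : List (ℕ × ℕ) :=
  [(0, 2), (0, 3), (0, 4), (1, 3), (1, 4), (1, 5), (2, 4), (2, 5), (3, 5)]

/-- A packing of quadruples in three hexagons, as binary numbers. For each hexagon it has
quadruples of three kinds: a side `x, x + 1` and points `p`, `q` of the next two hexagons with
`x + p + q = 2 * i` modulo `6`; a diagonal and a diagonal of the next hexagon whose sums agree
modulo `3`; and two of three disjoint sides. -/
def quadrupleMasks : List ℕ :=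
  (List.range 3).flatMap fun i =>
    (((List.range 6).product (List.range 6)).map fun (x, p) =>
      hexagonPoint i x + hexagonPoint i (x + 1) + hexagonPoint (i + 1) p +
        hexagonPoint (i + 2) (2 * i + 5 * x + 5 * p)) ++
    (((hexagonDiagonals.product hexagonDiagonals).filter fun ((x, y), p, q) =>
        (x + y) % 3 = (p + q) % 3).map fun ((x, y), p, q) =>
      hexagonPoint i x + hexagonPoint i y + hexagonPoint (i + 1) p + hexagonPoint (i + 1) q) ++
    [(0, 2), (0, 4), (2, 4)].map fun (x, y) =>
      hexagonPoint i x + hexagonPoint i (x + 1) + hexagonPoint i y + hexagonPoint i (y + 1)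

theorem isPacking_quadrupleMasks : IsPacking 3 198 (quadrupleMasks.map (bitSet 18)).toFinset :=
  isPacking_map_bitSet (by decide +kernel) (by decide +kernel) (by decide +kernel)

/-- A colouring of the `k`-sets in which different sets of the same colour share at most `k - 2`
elements. -/
def IsProperColouring {V ι : Type*} [DecidableEq V] (k : ℕ) (f : Finset V → ι) : Prop :=
  ∀ A B : Finset V, #A = k → #B = k → f A = f B → A ≠ B → #(A ∩ B) + 2 ≤ k

theorem isProperColouring_sum {G : Type*} [AddCommGroup G] [DecidableEq G] (k : ℕ) :
    IsProperColouring k fun A : Finset G => ∑ x ∈ A, x := by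
  intro A B hA hB hsum hne
  by_contra! hlt
  have hAB := card_sdiff_add_card_inter A B
  have hBA := card_sdiff_add_card_inter B A
  rw [inter_comm B A] at hBA
  have hpos : 0 < #(A \ B) := card_pos.2 <| sdiff_nonempty.2 fun hsub =>
    hne (eq_of_subset_of_card_le hsub (by omega))
  obtain ⟨a, ha⟩ := card_eq_one.1 (show #(A \ B) = 1 by omega)
  obtain ⟨b, hb⟩ := card_eq_one.1 (show #(B \ A) = 1 by omega)
  have hab : a = b := by
    have hsumA := sum_inter_add_sum_sdiff A B id
    have hsumB := sum_inter_add_sum_sdiff B A id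
    rw [inter_comm B A] at hsumB
    simp only [ha, hb, sum_singleton, id] at hsumA hsumB
    exact add_left_cancel (hsumA.trans (hsum.trans hsumB.symm))
  have haA : a ∈ A \ B := ha ▸ mem_singleton_self a
  have haB : a ∈ B \ A := hb ▸ hab ▸ mem_singleton_self a
  exact (Finset.mem_sdiff.1 haA).2 (Finset.mem_sdiff.1 haB).1

/-- A colouring of the triples of nine points by seven colours whose classes are Steiner triple
systems. The points below `7` stand for their residues modulo `7`, the points `7` and `8` are at
infinity; `s` and `t` are the sums of the residues in `A` and of their squares, so that
`2 * t - s ^ 2 = (x - y) ^ 2` when these residues are `x` and `y`, while `4` and `5` are the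
inverses of `2` and `3`. -/
def tripleColour (A : Finset (Fin 9)) : ZMod 7 :=
  let s : ZMod 7 := ∑ x ∈ A with x < 7, (x : ℕ)
  let t : ZMod 7 := ∑ x ∈ A with x < 7, (x : ℕ) ^ 2
  if 7 ∈ A then if 8 ∈ A then s else 4 * s - (2 * t - s ^ 2) ^ 2
  else if 8 ∈ A then 4 * s + (2 * t - s ^ 2) ^ 2 else 5 * s

theorem isProperColouring_tripleColour : IsProperColouring 3 tripleColour := by
  have hcheck : ∀ A ∈ powersetCard 3 univ, ∀ B ∈ powersetCard 3 univ,
      tripleColour A = tripleColour B → A ≠ B → #(A ∩ B) + 2 ≤ 3 := by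
    decide +kernel
  exact fun A B hA hB => hcheck A (mem_powersetCard_univ.2 hA) B (mem_powersetCard_univ.2 hB)

theorem card_tripleColour_eq : ∀ i : ZMod 7,
    #{A ∈ powersetCard 3 univ | tripleColour A = i} = 12 := by
  decide +kernel

theorem card_inter_eq_toLeft_add_toRight {V W : Type*} [DecidableEq V] [DecidableEq W]
    (S S' : Finset (V ⊕ W)) : #(S ∩ S') = #(S.toLeft ∩ S'.toLeft) + #(S.toRight ∩ S'.toRight) := by
  rw [← toLeft_inter, ← toRight_inter, card_toLeft_add_card_toRight]

theorem card_inter_lt_of_ne {V : Type*} [DecidableEq V] {A B : Finset V} {k : ℕ} (hA : #A = k)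
    (hB : #B = k) (hne : A ≠ B) : #(A ∩ B) < k := by
  refine hA ▸ card_lt_card (inter_subset_left.ssubset_of_ne fun h => hne ?_)
  exact eq_of_subset_of_card_le (inter_eq_left.1 h) (by omega)

section PairUp

variable {V W ι ι' : Type*} [Fintype V] [Fintype W] [DecidableEq ι] [DecidableEq ι']

/-- The unions of a `k`-set in the first half and an `l`-set of the same colour in the second. -/
def pairUp (k l : ℕ) (f : Finset V → ι) (g : Finset W → ι) : Finset (Finset (V ⊕ W)) :=
  univ.filter fun S => #S.toLeft = k ∧ #S.toRight = l ∧ f S.toLeft = g S.toRight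

theorem mem_pairUp {k l : ℕ} {f : Finset V → ι} {g : Finset W → ι} {S : Finset (V ⊕ W)} :
    S ∈ pairUp k l f g ↔ #S.toLeft = k ∧ #S.toRight = l ∧ f S.toLeft = g S.toRight :=
  mem_filter_univ S

theorem card_pairUp [Fintype ι] (k l : ℕ) (f : Finset V → ι) (g : Finset W → ι) :
    #(pairUp k l f g) = ∑ i, #{A ∈ powersetCard k univ | f A = i} *
      #{B ∈ powersetCard l univ | g B = i} := by
  rw [card_eq_sum_card_fiberwise (f := fun S => f S.toLeft) (t := univ) (by simp)]
  refine sum_congr rfl fun i _ => ?_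
  rw [← card_product]
  refine card_equiv sumEquiv.toEquiv fun S => ?_
  simp only [mem_filter, mem_pairUp, mem_product, mem_powersetCard_univ, RelIso.coe_fn_toEquiv,
    sumEquiv_apply_fst, sumEquiv_apply_snd]
  grind

variable [DecidableEq V] [DecidableEq W]

theorem card_inter_add_two_le_of_mem_pairUp {k l : ℕ} {f : Finset V → ι} {g : Finset W → ι}
    (hf : IsProperColouring k f) (hg : IsProperColouring l g) {S S' : Finset (V ⊕ W)}
    (hS : S ∈ pairUp k l f g) (hS' : S' ∈ pairUp k l f g) (hne : S ≠ S') :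
    #(S ∩ S') + 2 ≤ k + l := by
  obtain ⟨hk, hl, hfg⟩ := mem_pairUp.1 hS
  obtain ⟨hk', hl', hfg'⟩ := mem_pairUp.1 hS'
  rw [card_inter_eq_toLeft_add_toRight]
  by_cases hL : S.toLeft = S'.toLeft
  · have hR : S.toRight ≠ S'.toRight := fun hR => hne <| by
      rw [← S.toLeft_disjSum_toRight, hL, hR, S'.toLeft_disjSum_toRight]
    have := hg _ _ hl hl' (by rw [← hfg, ← hfg', hL]) hR
    rw [hL, inter_self]
    omega
  · by_cases hR : S.toRight = S'.toRight
    · have := hf _ _ hk hk' (by rw [hfg, hfg', hR]) hL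
      rw [hR, inter_self]
      omega
    · have := card_inter_lt_of_ne hk hk' hL
      have := card_inter_lt_of_ne hl hl' hR
      omega

theorem card_inter_le_of_mem_pairUp {k l k' l' : ℕ} {f : Finset V → ι} {g : Finset W → ι}
    {f' : Finset V → ι'} {g' : Finset W → ι'} {S S' : Finset (V ⊕ W)}
    (hS : S ∈ pairUp k l f g) (hS' : S' ∈ pairUp k' l' f' g') :
    #(S ∩ S') ≤ min k k' + min l l' := by
  obtain ⟨rfl, rfl, -⟩ := mem_pairUp.1 hS
  obtain ⟨rfl, rfl, -⟩ := mem_pairUp.1 hS'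
  rw [card_inter_eq_toLeft_add_toRight]
  exact add_le_add
    (le_min (card_le_card inter_subset_left) (card_le_card inter_subset_right))
    (le_min (card_le_card inter_subset_left) (card_le_card inter_subset_right))

end PairUp

/-- The sextuples in two copies of nine points which consist of two triples of the same colour, or
of a quintuple and of the point which is its sum modulo `9`. -/
def sextuples : Finset (Finset (Fin 9 ⊕ Fin 9)) :=
  pairUp 3 3 tripleColour tripleColour ∪
    (pairUp 1 5 (∑ x ∈ ·, x) (∑ x ∈ ·, x) ∪ pairUp 5 1 (∑ x ∈ ·, x) (∑ x ∈ ·, x))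

theorem card_sum_eq (i : Fin 9) :
    #{A ∈ powersetCard 1 univ | ∑ x ∈ A, x = i} = 1 ∧
      #{A ∈ powersetCard 5 univ | ∑ x ∈ A, x = i} = 14 := by
  revert i
  decide +kernel

theorem card_sextuples : #sextuples = 1260 := by
  rw [sextuples, card_union_of_disjoint, card_union_of_disjoint]
  · simp [card_pairUp, card_tripleColour_eq, card_sum_eq, ZMod.card]
  · refine disjoint_left.2 fun S hS hS' => ?_
    simp only [mem_pairUp] at hS hS'
    omega
  · refine disjoint_left.2 fun S hS hS' => ?_
    simp only [mem_union, mem_pairUp] at hS hS'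
    omega

theorem card_of_mem_sextuples {S : Finset (Fin 9 ⊕ Fin 9)} (hS : S ∈ sextuples) : #S = 6 := by
  rw [← card_toLeft_add_card_toRight]
  simp only [sextuples, mem_union, mem_pairUp] at hS
  omega

theorem card_inter_lt_of_mem_sextuples {S S' : Finset (Fin 9 ⊕ Fin 9)} (hS : S ∈ sextuples)
    (hS' : S' ∈ sextuples) (hne : S ≠ S') : #(S ∩ S') < 5 := by
  simp only [sextuples, mem_union] at hS hS'
  rcases hS with hS | hS | hS <;> rcases hS' with hS' | hS' | hS'
  case inl.inl =>
    have := card_inter_add_two_le_of_mem_pairUp isProperColouring_tripleColour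
      isProperColouring_tripleColour hS hS' hne
    omega
  case inr.inl.inr.inl | inr.inr.inr.inr =>
    have := card_inter_add_two_le_of_mem_pairUp (isProperColouring_sum _)
      (isProperColouring_sum _) hS hS' hne
    omega
  all_goals
    have := card_inter_le_of_mem_pairUp hS hS'
    omega

theorem isPacking_sextuples : IsPacking 5 1260
    (sextuples.map
      (mapEmbedding (finSumFinEquiv (m := 9) (n := 9)).toEmbedding).toEmbedding) := by
  simp only [IsPacking, card_map, Finset.mem_map, forall_exists_index, and_imp,
    forall_apply_eq_imp_iff₂, RelEmbedding.coe_toEmbedding, mapEmbedding_apply, ← map_inter]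
  exact ⟨card_sextuples, fun S hS => card_of_mem_sextuples hS,
    fun S hS S' hS' hne => card_inter_lt_of_mem_sextuples hS hS' (hne <| congrArg _ ·)⟩

theorem exists_mergeRun_mergeWord : ∃ P, MergeRun 18 mergeWord 0 0 P :=
  ⟨_, .row <| .col <| .rowMerge _ isPacking_pairMasks <| .colMerge _ isPacking_pairMasks <|
    .rowMerge _ isPacking_quadrupleMasks <| .colMerge _ isPacking_quadrupleMasks <|
    .rowMerge _ isPacking_sextuples <| .colMerge _ isPacking_sextuples <|
    .row <| .col <| .row <| .col <| .row <| .nil _ _⟩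

end Packings

/-! ### Circuits for the disjointness matrix -/

theorem exists_forall_le_mul_pow {f : ℕ → ℝ} {l b : ℝ} (hf : ∀ n, 0 ≤ f n)
    (hlim : Tendsto (fun n : ℕ => f n ^ (1 / (n : ℝ))) atTop (𝓝 l)) (hl : l < b) :
    ∃ K, 0 ≤ K ∧ ∀ n, f n ≤ K * b ^ n := by
  have hl₀ : 0 ≤ l := ge_of_tendsto' hlim fun n => Real.rpow_nonneg (hf n) _
  have hb : 0 < b := hl₀.trans_lt hl
  have hevent : ∀ᶠ n in atTop, ‖f n‖ ≤ 1 * ‖b ^ n‖ := by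
    filter_upwards [hlim.eventually_lt_const hl, eventually_ne_atTop 0] with n hn hn₀
    calc ‖f n‖ = (f n ^ (1 / (n : ℝ))) ^ n := by
          rw [one_div, Real.rpow_inv_natCast_pow (hf n) hn₀, Real.norm_of_nonneg (hf n)]
      _ ≤ b ^ n := pow_le_pow_left₀ (Real.rpow_nonneg (hf n) _) hn.le n
      _ = 1 * ‖b ^ n‖ := by rw [one_mul, Real.norm_of_nonneg (by positivity)]
  obtain ⟨K, hK, hbound⟩ := Asymptotics.bound_of_isBigO_nat_atTop (.of_bound 1 hevent)
  refine ⟨K, hK.le, fun n => (le_abs_self _).trans ((hbound (by positivity)).trans_eq ?_)⟩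
  rw [Real.norm_of_nonneg (by positivity)]

theorem exists_hasCircuit_two_of_sigmaPAR_lt {I : Type} [Finite I] [DecidableEq I]
    {M : Matrix I I ℕ} {b : ℝ} (hM : ∀ i j, M i j ≤ 1) {i j : I} (hij : M i j ≠ 0)
    (hb : sigmaPAR M < b) :
    ∃ K, 0 ≤ K ∧ ∀ (F : Type u) [CommSemiring F] (k : ℕ),
      HasCircuit (kroneckerPower (M.map (Nat.castRingHom F)) k) 2 (K * b ^ k) := by
  obtain ⟨K, hK, hsize⟩ := exists_forall_le_mul_pow (fun _ => Nat.cast_nonneg _)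
    (tendsto_sizePAR_rpow_sigmaPAR hM hij) hb
  refine ⟨K, hK, fun F _ k => ?_⟩
  obtain ⟨P, hP, hPsize⟩ := exists_isPartitioning_sizePAR (kroneckerPower_apply_le_one hM k)
  rw [← kroneckerPower_map]
  exact hP.hasCircuit.mono (hPsize ▸ hsize k)

theorem exists_hasCircuit_two_mul_of_sigmaPAR_lt {I : Type} [Fintype I] [DecidableEq I]
    {M : Matrix I I ℕ} {β : ℝ} (hM : ∀ i j, M i j ≤ 1) {i j : I} (hij : M i j ≠ 0) (hβ : 0 ≤ β)
    (hσ : sigmaPAR M < (Fintype.card I : ℝ) ^ (1 + β)) :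
    ∃ K : ℝ, ∀ (F : Type u) [CommSemiring F] (h k : ℕ), 1 ≤ h →
      HasCircuit (kroneckerPower (M.map (Nat.castRingHom F)) k) (2 * h)
        (h * K * ((Fintype.card I : ℝ) ^ k) ^ (1 + β / h)) := by
  have : Nonempty I := ⟨i⟩
  obtain ⟨K, hK, htwo⟩ := exists_hasCircuit_two_of_sigmaPAR_lt.{u} hM hij hσ
  refine ⟨K * Fintype.card I ^ β, fun F _ h k hh => ?_⟩
  rw [← mul_assoc]
  refine HasCircuit.kroneckerPower_mul_depth hK hβ (fun k => ?_) hh k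
  rw [← Real.rpow_pow_comm (Nat.cast_nonneg _)]
  exact htwo F k

theorem exists_hasCircuit_disjointnessMatrix {β : ℝ} (hβ : 0 ≤ β)
    (hσ : sigmaPAR (disjointnessMatrix ℕ) < 2 ^ (1 + β)) :
    ∃ K : ℝ, ∀ (F : Type u) [CommSemiring F] (h k : ℕ), 1 ≤ h →
      HasCircuit (kroneckerPower (disjointnessMatrix F) k) (2 * h)
        (h * K * ((2 : ℝ) ^ k) ^ (1 + β / h)) := by
  simpa only [Fintype.card_fin, Nat.cast_ofNat, disjointnessMatrix_map] using
    exists_hasCircuit_two_mul_of_sigmaPAR_lt.{u} disjointnessMatrix_apply_le_one (i := 0) (j := 0)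
      one_ne_zero hβ (by simpa using hσ)

theorem mainTheorem2_general :
    (∃ P, MergeRun 18 mergeWord 0 0 P) ∧
    (∀ P, MergeRun 18 mergeWord 0 0 P →
      IsPartitioning P
        ((kroneckerPower (disjointnessMatrix ℕ) 18).submatrix indicatorTuple indicatorTuple) ∧
      sigmaPAR (disjointnessMatrix ℕ) ≤ alphaVolume P (1 / 2) ^ (1 / 18 : ℝ) ∧
      alphaVolume P (1 / 2) ^ (1 / 18 : ℝ) < (2 : ℝ) ^ (1.249424 : ℝ)) ∧
    Tendsto (fun n : ℕ => (sizePAR (kroneckerPower (disjointnessMatrix ℕ) n) : ℝ) ^ (1 / (n : ℝ)))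
      atTop (𝓝 (sigmaPAR (disjointnessMatrix ℕ))) ∧
    (∃ K : ℝ, ∀ (F : Type u) [CommSemiring F] (k : ℕ),
      ∃ C : LinearCircuit F (Fin k → Fin 2) (Fin k → Fin 2) 2,
        C.matrix = kroneckerPower (disjointnessMatrix F) k ∧
        (C.size : ℝ) ≤ K * ((2 : ℝ) ^ k) ^ (1.249424 : ℝ)) ∧
    (∀ d : ℕ, 0 < d → Even d → ∃ K : ℝ, ∀ (F : Type u) [CommSemiring F] (k : ℕ),
      ∃ C : LinearCircuit F (Fin k → Fin 2) (Fin k → Fin 2) d,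
        C.matrix = kroneckerPower (disjointnessMatrix F) k ∧
        (C.size : ℝ) ≤ K * ((2 : ℝ) ^ k) ^ (1 + 0.498848 / (d : ℝ))) := by
  have hone : disjointnessMatrix ℕ 0 0 ≠ 0 := one_ne_zero
  have hvolume {P} (hP : MergeRun 18 mergeWord 0 0 P) :
      sigmaPAR (disjointnessMatrix ℕ) ≤ alphaVolume P (1 / 2) ^ (1 / 18 : ℝ) ∧
        alphaVolume P (1 / 2) ^ (1 / 18 : ℝ) < (2 : ℝ) ^ (1.249424 : ℝ) :=
    ⟨hP.hasVolumeBound.sigmaPAR_le disjointnessMatrix_apply_le_one hone (by norm_num),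
      hP.hasSizeTable.alphaVolume_eq _ ▸ rpow_tableVolume_mergeTable_lt⟩
  obtain ⟨P, hP⟩ := exists_mergeRun_mergeWord
  obtain ⟨K, hK⟩ := exists_hasCircuit_disjointnessMatrix.{u} (β := 0.249424) (by norm_num)
    ((hvolume hP).1.trans_lt ((hvolume hP).2.trans_eq (by norm_num)))
  refine ⟨⟨P, hP⟩, fun P hP => ⟨hP.isPartitioning (by decide), hvolume hP⟩,
    tendsto_sizePAR_rpow_sigmaPAR disjointnessMatrix_apply_le_one hone,
    ⟨K, fun F _ k => (hK F 1 k le_rfl).mono (by norm_num)⟩, fun d hd heven => ?_⟩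
  obtain ⟨h, rfl⟩ := heven.two_dvd
  refine ⟨h * K, fun F _ k => (hK F h k (by omega)).mono (le_of_eq ?_)⟩
  congr 3
  push_cast
  rw [← div_div]
  norm_num

theorem mainTheorem2 :
    -- the procedure can be carried out without failure
    (∃ P, MergeRun 18 mergeWord 0 0 P) ∧
    -- every output is a partitioning of the 18th power, and its volume bounds `σ_PAR`
    (∀ P, MergeRun 18 mergeWord 0 0 P →
      IsPartitioning P
        ((kroneckerPower (disjointnessMatrix ℕ) 18).submatrix indicatorTuple indicatorTuple) ∧
      sigmaPAR (disjointnessMatrix ℕ) ≤ alphaVolume P (1 / 2) ^ (1 / 18 : ℝ) ∧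
      alphaVolume P (1 / 2) ^ (1 / 18 : ℝ) < (2 : ℝ) ^ (1.249424 : ℝ)) ∧
    -- the limit defining `σ_PAR` exists
    Tendsto (fun n : ℕ => (sizePAR (kroneckerPower (disjointnessMatrix ℕ) n) : ℝ) ^ (1 / (n : ℝ)))
      atTop (𝓝 (sigmaPAR (disjointnessMatrix ℕ))) ∧
    -- circuits of depth two
    (∃ K : ℝ, ∀ (F : Type u) [Field F] (k : ℕ),
      ∃ C : LinearCircuit F (Fin k → Fin 2) (Fin k → Fin 2) 2,
        C.matrix = kroneckerPower (disjointnessMatrix F) k ∧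
        (C.size : ℝ) ≤ K * ((2 : ℝ) ^ k) ^ (1.249424 : ℝ)) ∧
    -- circuits of even depth `d`
    (∀ d : ℕ, 0 < d → Even d → ∃ K : ℝ, ∀ (F : Type u) [Field F] (k : ℕ),
      ∃ C : LinearCircuit F (Fin k → Fin 2) (Fin k → Fin 2) d,
        C.matrix = kroneckerPower (disjointnessMatrix F) k ∧
        (C.size : ℝ) ≤ K * ((2 : ℝ) ^ k) ^ (1 + 0.498848 / (d : ℝ))) := by
  obtain ⟨hrun, hvolume, hlim, hdepth₂, hdepth⟩ := mainTheorem2_general.{u}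
  exact ⟨hrun, hvolume, hlim, hdepth₂.imp fun _ h F _ => h F,
    fun d hd heven => (hdepth d hd heven).imp fun _ h F _ => h F⟩
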